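/- Let $N\ge 1$ be an integer, $k\in\{0,\dots,\lfloor (N-1)/2\rfloor\}$, $\alpha\in\mathbb R\setminus\{0\}$, $p>1$ and $\omega>\frac{\alpha^2}{(N-2k)^2}$. Let $\mathbb K$ be $\mathbb R$ or $\mathbb C$, let $L^2(\mathcal G)=\bigoplus_{j=1}^N L^2(\mathbb R_+;\mathbb K)$ with scalar product $(\cdot,\cdot)_2$ (linear in the first argument), and let $H^m(\mathcal G)=\bigoplus_{j=1}^N H^m(\mathbb R_+;\mathbb K)$ for $m=1,2$. For $a_k=\tanh^{-1}\!\big(\frac{\alpha}{(2k-N)\sqrt\omega}\big)$ define, for $x>0$, $$\varphi_{k,j}(x)=\Big[\tfrac{(p+1)\omega}{2}\,\mathrm{sech}^2\!\big(\tfrac{(p-1)\sqrt\omega}{2}x-a_k\big)\Big]^{\frac1{p-1}}\ (1\le j\le k),\qquad \varphi_{k,j}(x)=\Big[\tfrac{(p+1)\omega}{2}\,\mathrm{sech}^2\!\big(\tfrac{(p-1)\sqrt\omega}{2}x+a_k\big)\Big]^{\frac1{p-1}}\ (k<j\le N).$$ Let $\mathcal E=\{V\in H^1(\mathcal G): v_1(0)=\dots=v_N(0)\}$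 and $$D_\alpha=\Big\{V\in H^2(\mathcal G): v_1(0)=\dots=v_N(0),\ \sum_{j=1}^N v_j'(0)=\alpha v_1(0)\Big\}.$$ For $F,G\in\mathcal E$ put $$B^\alpha_{1,k}(F,G)=\sum_{j=1}^N\int_0^\infty\big(f_j'\overline{g_j'}+\omega f_j\overline{g_j}-p\,\varphi_{k,j}^{p-1}f_j\overline{g_j}\big)dx+\alpha f_1(0)\overline{g_1(0)},$$ $$B^\alpha_{2,k}(F,G)=\sum_{j=1}^N\int_0^\infty\big(f_j'\overline{g_j'}+\omega f_j\overline{g_j}-\varphi_{k,j}^{p-1}f_j\overline{g_j}\big)dx+\alpha f_1(0)\overline{g_1(0)}$$ (the conjugations are void if $\mathbb K=\mathbb R$). Then $B^\alpha_{1,k}$ and $B^\alpha_{2,k}$, with domain $\mathcal E$, are densely defined symmetric forms in $L^2(\mathcal G)$, bounded from below and closed. For $i\in\{1,2\}$ the operator $\mathbf L^\alpha_{i,k}$ associated with $B^\alpha_{i,k}$, that is, the operator given by $\mathbf L^\alpha_{i,k}V=W$ on $$\mathrm{dom}(\mathbf L^\alpha_{i,k})=\{V\in\mathcal E:\ \exists\,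 W\in L^2(\mathcal G)\ \ \forall Z\in\mathcal E,\ B^\alpha_{i,k}(V,Z)=(W,Z)_2\},$$ is well defined and self-adjoint, its domain is exactly $D_\alpha$, and for $V=(v_j)_{j=1}^N\in D_\alpha$ $$\mathbf L^\alpha_{1,k}V=\big(-v_j''+\omega v_j-p\,\varphi_{k,j}^{p-1}v_j\big)_{j=1}^N,\qquad \mathbf L^\alpha_{2,k}V=\big(-v_j''+\omega v_j-\varphi_{k,j}^{p-1}v_j\big)_{j=1}^N.$$ -/

import Mathlib

open scoped ENNReal Topology ComplexConjugate
open MeasureTheory Set Filter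

noncomputable section

namespace StarGraph

/-! ## Sobolev spaces on the half-line

The scalar field `𝕜` is `ℝ` or `ℂ`. -/

/-- Lebesgue measure on the half-line `(0, ∞)`. -/
abbrev halfLine : Measure ℝ := volume.restrict (Ioi (0 : ℝ))

/-- The space `L²(ℝ₊)`. -/
abbrev L2Half (𝕜 : Type*) [RCLike 𝕜] : Type _ := Lp 𝕜 2 halfLine

/-- `w ∈ L²(ℝ₊)` is the weak derivative of `u ∈ L²(ℝ₊)` on `(0, ∞)`:
`∫ φ' u = - ∫ φ w` for all test functions `φ ∈ C_c^∞((0, ∞))`. -/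
def HasWeakDeriv {𝕜 : Type*} [RCLike 𝕜] (u w : L2Half 𝕜) : Prop :=
  ∀ φ : ℝ → ℝ, ContDiff ℝ (⊤ : ℕ∞) φ → HasCompactSupport φ → tsupport φ ⊆ Ioi (0 : ℝ) →
    ∫ x in Ioi (0 : ℝ), deriv φ x • u x = - ∫ x in Ioi (0 : ℝ), φ x • w x

/-- `u ∈ H¹(ℝ₊)`. -/
def MemH1 {𝕜 : Type*} [RCLike 𝕜] (u : L2Half 𝕜) : Prop := ∃ w : L2Half 𝕜, HasWeakDeriv u w

open scoped Classical in
/-- The weak derivative `u'` of `u ∈ H¹(ℝ₊)` (and `0` if `u ∉ H¹(ℝ₊)`). -/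
def weakDeriv {𝕜 : Type*} [RCLike 𝕜] (u : L2Half 𝕜) : L2Half 𝕜 :=
  if h : MemH1 u then h.choose else 0

/-- `u ∈ H²(ℝ₊)`. -/
def MemH2 {𝕜 : Type*} [RCLike 𝕜] (u : L2Half 𝕜) : Prop := MemH1 u ∧ MemH1 (weakDeriv u)

/-- The function `u` has a representative which is continuous on `[0, ∞)`, and the value of this
representative at the end point `0` is `a`. -/
def HasValueAtZero {𝕜 : Type*} [RCLike 𝕜] (u : L2Half 𝕜) (a : 𝕜) : Prop :=
  ∃ f : ℝ → 𝕜, ContinuousOn f (Ici (0 : ℝ)) ∧ u =ᵐ[halfLine] f ∧ f 0 = a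

open scoped Classical in
/-- The boundary value `u(0)` (and `0` if `u` has no continuous representative). -/
def valueAtZero {𝕜 : Type*} [RCLike 𝕜] (u : L2Half 𝕜) : 𝕜 :=
  if h : ∃ a : 𝕜, HasValueAtZero u a then h.choose else 0

section Facts

variable {𝕜 : Type*} [RCLike 𝕜]

theorem integrable_test_smul {φ : ℝ → ℝ} (hφ : Continuous φ) (hc : HasCompactSupport φ)
    (u : L2Half 𝕜) : Integrable (fun x => φ x • u x) halfLine := by
  have h1 : MemLp φ 2 halfLine := (hφ.memLp_of_hasCompactSupport (μ := volume) hc).restrict _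
  exact memLp_one_iff_integrable.1 (MemLp.smul (r := 1) (Lp.memLp u) h1)

theorem HasWeakDeriv.add {u v w z : L2Half 𝕜} (hu : HasWeakDeriv u w) (hv : HasWeakDeriv v z) :
    HasWeakDeriv (u + v) (w + z) := by
  intro φ hφ hc hs
  have hd : Continuous (deriv φ) := hφ.continuous_deriv (by simp)
  have e1 : ∫ x in Ioi (0 : ℝ), deriv φ x • (u + v : L2Half 𝕜) x
      = ∫ x in Ioi (0 : ℝ), (deriv φ x • u x + deriv φ x • v x) := by
    refine integral_congr_ae ?_
    filter_upwards [Lp.coeFn_add u v] with x hx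
    rw [hx, Pi.add_apply, smul_add]
  have e2 : ∫ x in Ioi (0 : ℝ), φ x • (w + z : L2Half 𝕜) x
      = ∫ x in Ioi (0 : ℝ), (φ x • w x + φ x • z x) := by
    refine integral_congr_ae ?_
    filter_upwards [Lp.coeFn_add w z] with x hx
    rw [hx, Pi.add_apply, smul_add]
  rw [e1, e2, integral_add (integrable_test_smul hd hc.deriv u) (integrable_test_smul hd hc.deriv v),
    integral_add (integrable_test_smul hφ.continuous hc w)
      (integrable_test_smul hφ.continuous hc z), hu φ hφ hc hs, hv φ hφ hc hs, neg_add]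

theorem HasWeakDeriv.smul {u w : L2Half 𝕜} (c : 𝕜) (hu : HasWeakDeriv u w) :
    HasWeakDeriv (c • u) (c • w) := by
  intro φ hφ hc hs
  have e1 : ∫ x in Ioi (0 : ℝ), deriv φ x • (c • u : L2Half 𝕜) x
      = ∫ x in Ioi (0 : ℝ), c • (deriv φ x • u x) := by
    refine integral_congr_ae ?_
    filter_upwards [Lp.coeFn_smul c u] with x hx
    rw [hx, Pi.smul_apply, smul_comm]
  have e2 : ∫ x in Ioi (0 : ℝ), φ x • (c • w : L2Half 𝕜) x
      = ∫ x in Ioi (0 : ℝ), c • (φ x • w x) := by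
    refine integral_congr_ae ?_
    filter_upwards [Lp.coeFn_smul c w] with x hx
    rw [hx, Pi.smul_apply, smul_comm]
  rw [e1, e2, integral_smul, integral_smul, hu φ hφ hc hs, smul_neg]

theorem HasWeakDeriv.zero : HasWeakDeriv (0 : L2Half 𝕜) 0 := by
  intro φ _ _ _
  have e (ψ : ℝ → ℝ) : ∫ x in Ioi (0 : ℝ), ψ x • (0 : L2Half 𝕜) x = 0 := by
    rw [← integral_zero ℝ 𝕜 (μ := halfLine)]
    refine integral_congr_ae ?_
    filter_upwards [Lp.coeFn_zero 𝕜 2 halfLine] with x hx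
    simp only [hx, Pi.zero_apply, smul_zero]
  rw [e, e, neg_zero]

/-- Weak derivatives are unique. -/
theorem HasWeakDeriv.unique {u w z : L2Half 𝕜} (hw : HasWeakDeriv u w) (hz : HasWeakDeriv u z) :
    w = z := by
  have key : ∀ᵐ x ∂(volume : Measure ℝ), x ∈ Ioi (0 : ℝ) → w x - z x = 0 := by
    refine isOpen_Ioi.ae_eq_zero_of_integral_contDiff_smul_eq_zero ?_ ?_
    · have hwz : MemLp (fun x => w x - z x) 2 halfLine := (Lp.memLp w).sub (Lp.memLp z)
      exact (hwz.locallyIntegrable (by norm_num)).locallyIntegrableOn (s := univ) |>.mono_set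
        (subset_univ _) |> fun h => by
          refine (locallyIntegrableOn_iff isOpen_Ioi.isLocallyClosed).2 fun K hK hKc => ?_
          have := (locallyIntegrableOn_iff isOpen_Ioi.isLocallyClosed).1 h K hK hKc
          rwa [IntegrableOn, Measure.restrict_restrict hKc.measurableSet,
            inter_eq_left.2 hK] at this
    · intro g hg hc hs
      have h0 : ∫ x, g x • (w x - z x) = ∫ x in Ioi (0 : ℝ), g x • (w x - z x) := by
        refine (setIntegral_eq_integral_of_forall_compl_eq_zero fun x hx => ?_).symm
        rw [image_eq_zero_of_notMem_tsupport fun h => hx (hs h), zero_smul]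
      rw [h0]
      simp only [smul_sub]
      rw [integral_sub (integrable_test_smul hg.continuous hc w)
        (integrable_test_smul hg.continuous hc z), sub_eq_zero, ← neg_inj,
        ← hw g hg hc hs, ← hz g hg hc hs]
  refine Lp.ext ?_
  rw [EventuallyEq, ae_restrict_iff' measurableSet_Ioi]
  filter_upwards [key] with x hx h using sub_eq_zero.1 (hx h)

theorem MemH1.hasWeakDeriv {u : L2Half 𝕜} (h : MemH1 u) : HasWeakDeriv u (weakDeriv u) := by
  rw [weakDeriv, dif_pos h]; exact h.choose_spec

theorem HasWeakDeriv.weakDeriv_eq {u w : L2Half 𝕜} (h : HasWeakDeriv u w) : weakDeriv u = w :=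
  (MemH1.hasWeakDeriv ⟨w, h⟩).unique h

theorem MemH1.add {u v : L2Half 𝕜} (hu : MemH1 u) (hv : MemH1 v) : MemH1 (u + v) :=
  ⟨_, hu.hasWeakDeriv.add hv.hasWeakDeriv⟩

theorem MemH1.smul {u : L2Half 𝕜} (c : 𝕜) (hu : MemH1 u) : MemH1 (c • u) :=
  ⟨_, hu.hasWeakDeriv.smul c⟩

theorem weakDeriv_add {u v : L2Half 𝕜} (hu : MemH1 u) (hv : MemH1 v) :
    weakDeriv (u + v) = weakDeriv u + weakDeriv v :=
  (hu.hasWeakDeriv.add hv.hasWeakDeriv).weakDeriv_eq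

theorem weakDeriv_smul {u : L2Half 𝕜} (c : 𝕜) (hu : MemH1 u) :
    weakDeriv (c • u) = c • weakDeriv u :=
  (hu.hasWeakDeriv.smul c).weakDeriv_eq

theorem weakDeriv_zero : weakDeriv (0 : L2Half 𝕜) = 0 := HasWeakDeriv.zero.weakDeriv_eq

theorem MemH2.add {u v : L2Half 𝕜} (hu : MemH2 u) (hv : MemH2 v) : MemH2 (u + v) :=
  ⟨hu.1.add hv.1, by rw [weakDeriv_add hu.1 hv.1]; exact hu.2.add hv.2⟩

theorem MemH2.smul {u : L2Half 𝕜} (c : 𝕜) (hu : MemH2 u) : MemH2 (c • u) :=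
  ⟨hu.1.smul c, by rw [weakDeriv_smul c hu.1]; exact hu.2.smul c⟩

theorem HasValueAtZero.add {u v : L2Half 𝕜} {a b : 𝕜} (hu : HasValueAtZero u a)
    (hv : HasValueAtZero v b) : HasValueAtZero (u + v) (a + b) := by
  obtain ⟨f, hf, huf, rfl⟩ := hu
  obtain ⟨g, hg, hvg, rfl⟩ := hv
  exact ⟨f + g, hf.add hg, (Lp.coeFn_add u v).trans (huf.add hvg), rfl⟩

theorem HasValueAtZero.smul {u : L2Half 𝕜} {a : 𝕜} (c : 𝕜) (hu : HasValueAtZero u a) :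
    HasValueAtZero (c • u) (c * a) := by
  obtain ⟨f, hf, huf, rfl⟩ := hu
  exact ⟨c • f, hf.const_smul c, (Lp.coeFn_smul c u).trans (huf.const_smul c), rfl⟩

theorem HasValueAtZero.zero : HasValueAtZero (0 : L2Half 𝕜) 0 :=
  ⟨0, continuousOn_const, Lp.coeFn_zero 𝕜 2 halfLine, rfl⟩

/-- Boundary values are unique. -/
theorem HasValueAtZero.unique {u : L2Half 𝕜} {a b : 𝕜} (ha : HasValueAtZero u a)
    (hb : HasValueAtZero u b) : a = b := by
  obtain ⟨f, hf, huf, rfl⟩ := ha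
  obtain ⟨g, hg, hug, rfl⟩ := hb
  have h : f =ᵐ[volume.restrict (Ici (0 : ℝ))] g := by
    rw [← restrict_Ioi_eq_restrict_Ici]
    exact huf.symm.trans hug
  exact Measure.eqOn_of_ae_eq h hf hg (by simp) (mem_Ici.2 le_rfl)

theorem HasValueAtZero.valueAtZero_eq {u : L2Half 𝕜} {a : 𝕜} (h : HasValueAtZero u a) :
    valueAtZero u = a := by
  have h' : ∃ a : 𝕜, HasValueAtZero u a := ⟨a, h⟩
  rw [valueAtZero, dif_pos h']
  exact h'.choose_spec.unique h

end Facts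

/-! ## The star graph with `N` edges -/

/-- The Hilbert space `L²(𝒢) = ⨁ L²(ℝ₊)` (`N` summands), with its `ℓ²`-sum inner product. -/
abbrev L2Star (𝕜 : Type*) [RCLike 𝕜] (N : ℕ) : Type _ := PiLp 2 (fun _ : Fin N => L2Half 𝕜)

/-- The energy space `ℰ`: the `V ∈ H¹(𝒢)` with `v₁(0) = ⋯ = v_N(0)`. -/
def energySpace (𝕜 : Type*) [RCLike 𝕜] (N : ℕ) : Submodule 𝕜 (L2Star 𝕜 N) where
  carrier := {V | (∀ j, MemH1 (V j)) ∧ ∃ a : 𝕜, ∀ j, HasValueAtZero (V j) a}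
  add_mem' := by
    rintro U V ⟨hU, a, ha⟩ ⟨hV, b, hb⟩
    exact ⟨fun j => (hU j).add (hV j), a + b, fun j => (ha j).add (hb j)⟩
  zero_mem' := ⟨fun _ => ⟨0, HasWeakDeriv.zero⟩, 0, fun _ => HasValueAtZero.zero⟩
  smul_mem' := by
    rintro c U ⟨hU, a, ha⟩
    exact ⟨fun j => (hU j).smul c, c * a, fun j => (ha j).smul c⟩

/-- The domain `D_α`: the `V ∈ H²(𝒢)` with `v₁(0) = ⋯ = v_N(0)` (`= a` in the code) and
`∑ v_j'(0) = α v₁(0)`. -/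
def deltaDomain (𝕜 : Type*) [RCLike 𝕜] (N : ℕ) (α : ℝ) : Submodule 𝕜 (L2Star 𝕜 N) where
  carrier := {V | (∀ j, MemH2 (V j)) ∧ ∃ (a : 𝕜) (b : Fin N → 𝕜),
    (∀ j, HasValueAtZero (V j) a) ∧ (∀ j, HasValueAtZero (weakDeriv (V j)) (b j)) ∧
      ∑ j, b j = (α : 𝕜) * a}
  add_mem' := by
    rintro U V ⟨hU, a, b, ha, hb, hab⟩ ⟨hV, c, d, hc, hd, hcd⟩
    refine ⟨fun j => (hU j).add (hV j), a + c, b + d, fun j => (ha j).add (hc j), fun j => ?_, ?_⟩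
    · rw [PiLp.add_apply, weakDeriv_add (hU j).1 (hV j).1]
      exact (hb j).add (hd j)
    · simp only [Pi.add_apply, Finset.sum_add_distrib, hab, hcd, mul_add]
  zero_mem' := by
    refine ⟨fun _ => ⟨⟨0, HasWeakDeriv.zero⟩, ?_⟩, 0, 0, fun _ => HasValueAtZero.zero,
      fun _ => ?_, by simp⟩
    · rw [PiLp.zero_apply, weakDeriv_zero]; exact ⟨0, HasWeakDeriv.zero⟩
    · rw [PiLp.zero_apply, weakDeriv_zero]; exact HasValueAtZero.zero
  smul_mem' := by
    rintro c U ⟨hU, a, b, ha, hb, hab⟩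
    refine ⟨fun j => (hU j).smul c, c * a, c • b, fun j => (ha j).smul c, fun j => ?_, ?_⟩
    · rw [PiLp.smul_apply, weakDeriv_smul c (hU j).1]
      exact (hb j).smul c
    · simp only [Pi.smul_apply, smul_eq_mul, ← Finset.mul_sum, hab]
      ring

/-! ## The profiles and the forms -/

/-- The shift `a_k = artanh (α / ((2k - N) √ω))`. -/
def profileShift (N k : ℕ) (α ω : ℝ) : ℝ :=
  Real.artanh (α / ((2 * (k : ℝ) - N) * √ω))

/-- The profile `φ_{k,j}`; the edges `1, …, k` are the indices `j : Fin N` with `j < k`. -/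
def profile (N k : ℕ) (α ω p : ℝ) (j : Fin N) (x : ℝ) : ℝ :=
  ((p + 1) * ω / 2 *
    (1 / Real.cosh ((p - 1) * √ω / 2 * x +
      (if (j : ℕ) < k then - profileShift N k α ω else profileShift N k α ω))) ^ 2) ^ (1 / (p - 1))

/-- The form
`∑_j ∫_0^∞ (f_j' g_j' + ω f_j g_j - c φ_{k,j}^{p-1} f_j g_j) dx + α f_1(0) g_1(0)`, with complex
conjugation on the second argument if `𝕜 = ℂ`. -/
def form (𝕜 : Type*) [RCLike 𝕜] (N k : ℕ) [NeZero N] (α ω p c : ℝ) (F G : L2Star 𝕜 N) : 𝕜 :=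
  (∑ j, ∫ x in Ioi (0 : ℝ),
      (weakDeriv (F j) x * conj (weakDeriv (G j) x) + (ω : 𝕜) * (F j x * conj (G j x))
        - ((c * profile N k α ω p j x ^ (p - 1) : ℝ) : 𝕜) * (F j x * conj (G j x))))
    + (α : 𝕜) * (valueAtZero (F 0) * conj (valueAtZero (G 0)))

/-- The form `B^α_{1,k}` (on the domain `ℰ`). -/
def formB1 (𝕜 : Type*) [RCLike 𝕜] (N k : ℕ) [NeZero N] (α ω p : ℝ) :
    L2Star 𝕜 N → L2Star 𝕜 N → 𝕜 := form 𝕜 N k α ω p p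

/-- The form `B^α_{2,k}` (on the domain `ℰ`). -/
def formB2 (𝕜 : Type*) [RCLike 𝕜] (N k : ℕ) [NeZero N] (α ω p : ℝ) :
    L2Star 𝕜 N → L2Star 𝕜 N → 𝕜 := form 𝕜 N k α ω p 1

/-- `t` is a densely defined, symmetric (Hermitian), semibounded, closed sesquilinear form with
domain `D`. -/
structure IsClosedSemiboundedForm {𝕜 H : Type*} [RCLike 𝕜] [NormedAddCommGroup H]
    [InnerProductSpace 𝕜 H] (D : Submodule 𝕜 H) (t : H → H → 𝕜) : Prop where
  dense : Dense (D : Set H)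
  add_left : ∀ u ∈ D, ∀ v ∈ D, ∀ z ∈ D, t (u + v) z = t u z + t v z
  smul_left : ∀ (c : 𝕜), ∀ u ∈ D, ∀ z ∈ D, t (c • u) z = c * t u z
  symm : ∀ u ∈ D, ∀ v ∈ D, t v u = conj (t u v)
  bounded_below : ∃ γ : ℝ, ∀ u ∈ D, γ * ‖u‖ ^ 2 ≤ RCLike.re (t u u)
  closed : ∀ (u : ℕ → H) (v : H), (∀ n, u n ∈ D) → Tendsto u atTop (𝓝 v) →
    (∀ ε : ℝ, 0 < ε → ∃ n₀ : ℕ, ∀ m n : ℕ, n₀ ≤ m → n₀ ≤ n →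
      ‖t (u n - u m) (u n - u m)‖ < ε) →
    v ∈ D ∧ Tendsto (fun n => t (u n - v) (u n - v)) atTop (𝓝 0)

/-- `L` is the operator associated with the form `t` with domain `D`: its domain is
`{V ∈ D : ∃ W ∈ H, ∀ Z ∈ D, t(V, Z) = (W, Z)}`, and `L V = W`. The inner product
`(W, Z)`, linear in `W`, is `inner 𝕜 Z W`. -/
def IsAssociatedOperator {𝕜 H : Type*} [RCLike 𝕜] [NormedAddCommGroup H]
    [InnerProductSpace 𝕜 H] (D : Submodule 𝕜 H) (t : H → H → 𝕜) (L : H →ₗ.[𝕜] H) : Prop :=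
  (∀ V : H, V ∈ L.domain ↔ V ∈ D ∧ ∃ W : H, ∀ Z ∈ D, t V Z = inner 𝕜 Z W) ∧
    ∀ V : L.domain, ∀ Z ∈ D, t V Z = inner 𝕜 Z (L V)

/-! ## The diagonal Schrödinger operators -/

/-- Multiplication by a bounded real function on `L²(ℝ₊)`. -/
def mulBounded {𝕜 : Type*} [RCLike 𝕜] (q : ℝ → ℝ) (hq : MemLp q ∞ halfLine) :
    L2Half 𝕜 →ₗ[𝕜] L2Half 𝕜 where
  toFun u := MemLp.toLp (fun x => (q x : 𝕜) * u x) (MemLp.mul' (r := 2) (p := ∞) (q := 2) (Lp.memLp u) hq.ofReal)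
  map_add' u v := by
    refine Lp.ext ?_
    refine (MemLp.coeFn_toLp _).trans ?_
    filter_upwards [Lp.coeFn_add u v, Lp.coeFn_add (MemLp.toLp (fun x => (q x : 𝕜) * u x)
        (MemLp.mul' (r := 2) (p := ∞) (q := 2) (Lp.memLp u) hq.ofReal)) (MemLp.toLp (fun x => (q x : 𝕜) * v x)
        (MemLp.mul' (r := 2) (p := ∞) (q := 2) (Lp.memLp v) hq.ofReal)),
      MemLp.coeFn_toLp (MemLp.mul' (Lp.memLp u) (hq.ofReal (K := 𝕜)) (r := 2)),
      MemLp.coeFn_toLp (MemLp.mul' (Lp.memLp v) (hq.ofReal (K := 𝕜)) (r := 2))] with x h1 h2 h3 h4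
    rw [h2, Pi.add_apply, h3, h4, h1, Pi.add_apply, mul_add]
  map_smul' c u := by
    refine Lp.ext ?_
    refine (MemLp.coeFn_toLp _).trans ?_
    filter_upwards [Lp.coeFn_smul c u, Lp.coeFn_smul c (MemLp.toLp (fun x => (q x : 𝕜) * u x)
        (MemLp.mul' (r := 2) (p := ∞) (q := 2) (Lp.memLp u) hq.ofReal)),
      MemLp.coeFn_toLp (MemLp.mul' (Lp.memLp u) (hq.ofReal (K := 𝕜)) (r := 2))] with x h1 h2 h3
    rw [RingHom.id_apply, h2, Pi.smul_apply, h3, h1, Pi.smul_apply, smul_eq_mul, smul_eq_mul]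
    ring

/-- The potential `ω - c φ_{k,j}^{p-1}`. -/
def potential (N k : ℕ) (α ω p c : ℝ) (j : Fin N) (x : ℝ) : ℝ :=
  ω - c * profile N k α ω p j x ^ (p - 1)

theorem memLp_potential {N k : ℕ} {α ω p : ℝ} (c : ℝ) (hp : 1 < p)
    (hω : α ^ 2 / ((N : ℝ) - 2 * k) ^ 2 < ω) (j : Fin N) :
    MemLp (potential N k α ω p c j) ∞ halfLine := by
  have hω0 : 0 < ω := lt_of_le_of_lt (by positivity) hω
  have hp' : p - 1 ≠ 0 := by linarith
  have e : ∀ x, profile N k α ω p j x ^ (p - 1) = (p + 1) * ω / 2 *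
      (1 / Real.cosh ((p - 1) * √ω / 2 * x +
      (if (j : ℕ) < k then - profileShift N k α ω else profileShift N k α ω))) ^ 2 := by
    intro x
    rw [profile, ← Real.rpow_mul (by positivity), one_div_mul_cancel hp', Real.rpow_one]
  have hc : Continuous (potential N k α ω p c j) := by
    unfold potential
    simp only [e]
    have : ∀ y : ℝ, Real.cosh y ≠ 0 := fun y => (Real.cosh_pos y).ne'
    have hcosh := Real.continuous_cosh
    fun_prop (disch := simp [this])
  refine memLp_top_of_bound hc.aestronglyMeasurable (ω + |c| * ((p + 1) * ω / 2)) (.of_forall ?_)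
  intro x
  rw [potential, e, Real.norm_eq_abs]
  refine (abs_sub _ _).trans ?_
  rw [abs_of_pos hω0, abs_mul]
  gcongr
  rw [abs_of_nonneg (by positivity)]
  refine mul_le_of_le_one_right (by positivity) (pow_le_one₀ (by positivity) ?_)
  rw [div_le_one (Real.cosh_pos _)]
  exact Real.one_le_cosh _

/-- The diagonal operator `V ↦ (- v_j'' + q_j v_j)_j` with domain `D_α`, for bounded real
potentials `q_j`. -/
def schrodinger (𝕜 : Type*) [RCLike 𝕜] {N : ℕ} (α : ℝ) (q : Fin N → ℝ → ℝ)
    (hq : ∀ j, MemLp (q j) ∞ halfLine) : L2Star 𝕜 N →ₗ.[𝕜] L2Star 𝕜 N where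
  domain := deltaDomain 𝕜 N α
  toFun :=
    { toFun := fun V => WithLp.toLp 2 fun j =>
        - weakDeriv (weakDeriv (V.1 j)) + mulBounded (q j) (hq j) (V.1 j)
      map_add' := fun U V => by
        ext1 j
        simp only [Submodule.coe_add, PiLp.add_apply, map_add]
        rw [weakDeriv_add (U.2.1 j).1 (V.2.1 j).1, weakDeriv_add (U.2.1 j).2 (V.2.1 j).2]
        abel
      map_smul' := fun c U => by
        ext1 j
        simp only [Submodule.coe_smul, PiLp.smul_apply, map_smul, RingHom.id_apply, smul_add,
          smul_neg]
        rw [weakDeriv_smul c (U.2.1 j).1, weakDeriv_smul c (U.2.1 j).2] }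

end StarGraph

end

/-!
The trace inequality `|u(0)|² ≤ 2 ‖u‖ ‖u'‖` makes the potential and the vertex term of the form a
perturbation of `‖V'‖²` with relative bound `1/2`, so the form is bounded from below and closed: a
sequence which is Cauchy for the form has Cauchy derivatives, and both the weak derivative and the
vertex values pass to the limit. A suitable shift of the form turns its domain into a Hilbert space,
where Riesz representation shows that a shift of the associated operator is surjective; being
symmetric, the operator is then self-adjoint. Finally, if `W` represents `B(V, ·)`, test functions
on a single edge give `V ∈ H²(𝒢)` and the formula for `W`, and `e^{-x}` on all edges gives the
vertex condition.
-/

noncomputable section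

namespace StarGraph

/-! ## Closed semibounded forms and their associated operators -/

section SelfAdjoint

variable {𝕜 H : Type*} [RCLike 𝕜] [NormedAddCommGroup H] [InnerProductSpace 𝕜 H]

theorem inner_add_ofReal_smul_left_of_isFormalAdjoint {T S : H →ₗ.[𝕜] H} (h : T.IsFormalAdjoint S)
    (c : ℝ) (U : T.domain) (V : S.domain) :
    inner 𝕜 (T U + (c : 𝕜) • (U : H)) (V : H) = inner 𝕜 (U : H) (S V + (c : 𝕜) • (V : H)) := by
  rw [inner_add_left, inner_add_right, inner_smul_left, inner_smul_right, RCLike.conj_ofReal,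
    h U V]

variable [CompleteSpace H] {L : H →ₗ.[𝕜] H}

theorem dense_domain_of_isFormalAdjoint_of_surjective (h : L.IsFormalAdjoint L) (c : ℝ)
    (hsurj : ∀ g, ∃ U : L.domain, L U + (c : 𝕜) • (U : H) = g) : Dense (L.domain : Set H) := by
  rw [Submodule.dense_iff_topologicalClosure_eq_top, Submodule.topologicalClosure_eq_top_iff,
    Submodule.eq_bot_iff]
  intro g hg
  obtain ⟨U, rfl⟩ := hsurj g
  obtain ⟨V, hV⟩ := hsurj U
  have hU : inner 𝕜 (U : H) (U : H) = 0 := by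
    nth_rw 1 [← hV]
    rw [inner_add_ofReal_smul_left_of_isFormalAdjoint h]
    exact (Submodule.mem_orthogonal _ _).1 hg V V.2
  obtain rfl : U = 0 := Subtype.ext (inner_self_eq_zero.1 hU)
  rw [LinearPMap.map_zero, Submodule.coe_zero, smul_zero, add_zero]

theorem isSelfAdjoint_of_isFormalAdjoint_of_surjective (h : L.IsFormalAdjoint L) (c : ℝ)
    (hsurj : ∀ g, ∃ U : L.domain, L U + (c : 𝕜) • (U : H) = g) : IsSelfAdjoint L := by
  have hdense := dense_domain_of_isFormalAdjoint_of_surjective h c hsurj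
  have hle : L ≤ L.adjoint := LinearPMap.IsFormalAdjoint.le_adjoint hdense h
  refine LinearPMap.isSelfAdjoint_def.2
    (LinearPMap.eq_of_le_of_domain_eq hle (le_antisymm hle.1 fun V hV => ?_)).symm
  obtain ⟨U, hU⟩ := hsurj (L.adjoint ⟨V, hV⟩ + (c : 𝕜) • V)
  have hUV : (U : H) = V := ext_inner_right 𝕜 fun g => by
    obtain ⟨Z, rfl⟩ := hsurj g
    rw [← inner_add_ofReal_smul_left_of_isFormalAdjoint h, hU]
    exact inner_add_ofReal_smul_left_of_isFormalAdjoint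
      (LinearPMap.adjoint_isFormalAdjoint hdense) c ⟨V, hV⟩ Z
  exact hUV ▸ U.2

end SelfAdjoint

section Forms

variable {𝕜 H : Type*} [RCLike 𝕜] [NormedAddCommGroup H] [InnerProductSpace 𝕜 H]
  {D : Submodule 𝕜 H} {t : H → H → 𝕜}

namespace IsClosedSemiboundedForm

/-- A constant `c` for which the shifted form `t + c` satisfies `t(u, u) + c ‖u‖² ≥ ‖u‖²`. -/
def shift (ht : IsClosedSemiboundedForm D t) : ℝ := 1 - ht.bounded_below.choose

theorem sq_norm_le (ht : IsClosedSemiboundedForm D t) {u : H} (hu : u ∈ D) :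
    ‖u‖ ^ 2 ≤ RCLike.re (t u u) + ht.shift * ‖u‖ ^ 2 := by
  have h := ht.bounded_below.choose_spec u hu
  rw [shift]
  linarith

/-- The domain `D` of a closed semibounded form `t` as a Hilbert space, with inner product
`t(u, v) + c (u, v)`, where `c = ht.shift`. A copy of `D`, so that its topology is not that of the
ambient space. -/
def FormDomain (_ : IsClosedSemiboundedForm D t) : Type _ := D

variable (ht : IsClosedSemiboundedForm D t)

instance : AddCommGroup ht.FormDomain := inferInstanceAs (AddCommGroup D)

instance : Module 𝕜 ht.FormDomain := inferInstanceAs (Module 𝕜 D)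

namespace FormDomain

/-- The inclusion of the form domain into the ambient space. -/
def incl : ht.FormDomain →ₗ[𝕜] H := D.subtype

variable {ht}

theorem incl_mem (x : ht.FormDomain) : incl ht x ∈ D := x.2

variable (ht)

/-- The inner product `(x, y) ↦ t(y, x) + c (y, x)`; the order of the arguments is reversed because
forms are linear in the first argument and `inner` in the second. -/
abbrev core : InnerProductSpace.Core 𝕜 ht.FormDomain where
  inner x y := t (incl ht y) (incl ht x) + (ht.shift : 𝕜) * inner 𝕜 (incl ht x) (incl ht y)
  conj_inner_symm x y := by
    rw [map_add, map_mul, inner_conj_symm, RCLike.conj_ofReal,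
      ← ht.symm _ x.incl_mem _ y.incl_mem]
  re_inner_nonneg x := by
    rw [map_add, RCLike.re_ofReal_mul, inner_self_eq_norm_sq]
    exact (sq_nonneg _).trans (ht.sq_norm_le x.incl_mem)
  add_left x y z := by
    rw [map_add, ht.symm _ (D.add_mem x.incl_mem y.incl_mem) _ z.incl_mem,
      ht.add_left _ x.incl_mem _ y.incl_mem _ z.incl_mem, map_add,
      ← ht.symm _ x.incl_mem _ z.incl_mem, ← ht.symm _ y.incl_mem _ z.incl_mem, inner_add_left]
    ring
  smul_left x y r := by
    rw [map_smul, ht.symm _ (D.smul_mem r x.incl_mem) _ y.incl_mem,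
      ht.smul_left _ _ x.incl_mem _ y.incl_mem, map_mul,
      ← ht.symm _ x.incl_mem _ y.incl_mem, inner_smul_left]
    ring
  definite x h := by
    have hre := congrArg RCLike.re h
    rw [map_add, RCLike.re_ofReal_mul, inner_self_eq_norm_sq, map_zero] at hre
    have hx : ‖incl ht x‖ ^ 2 ≤ 0 := (ht.sq_norm_le x.incl_mem).trans hre.le
    exact Subtype.ext
      (norm_eq_zero.1 (pow_eq_zero_iff two_ne_zero |>.1 (hx.antisymm (sq_nonneg _))))

instance : NormedAddCommGroup ht.FormDomain := (core ht).toNormedAddCommGroup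

instance : InnerProductSpace 𝕜 ht.FormDomain := InnerProductSpace.ofCore (core ht).toCore

variable {ht}

theorem inner_eq (x y : ht.FormDomain) : inner 𝕜 x y =
    t (incl ht y) (incl ht x) + (ht.shift : 𝕜) * inner 𝕜 (incl ht x) (incl ht y) := rfl

theorem norm_sq_eq (x : ht.FormDomain) :
    ‖x‖ ^ 2 = RCLike.re (t (incl ht x) (incl ht x)) + ht.shift * ‖incl ht x‖ ^ 2 := by
  rw [← inner_self_eq_norm_sq (𝕜 := 𝕜), inner_eq, map_add, RCLike.re_ofReal_mul,
    inner_self_eq_norm_sq]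

theorem norm_incl_le (x : ht.FormDomain) : ‖incl ht x‖ ≤ ‖x‖ := by
  refine le_of_sq_le_sq ?_ (norm_nonneg _)
  rw [norm_sq_eq]
  exact ht.sq_norm_le x.incl_mem

theorem norm_form_self_le (x : ht.FormDomain) :
    ‖t (incl ht x) (incl ht x)‖ ≤ (1 + |ht.shift|) * ‖x‖ ^ 2 := by
  rw [← add_sub_cancel_right (t (incl ht x) (incl ht x))
    ((ht.shift : 𝕜) * inner 𝕜 (incl ht x) (incl ht x)), ← inner_eq]
  refine (norm_sub_le _ _).trans ?_
  rw [norm_mul, inner_self_eq_norm_sq_to_K, inner_self_eq_norm_sq_to_K, norm_pow, norm_pow,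
    RCLike.norm_ofReal, RCLike.norm_ofReal, RCLike.norm_ofReal, abs_norm, abs_norm, add_mul,
    one_mul]
  gcongr
  exact norm_incl_le x

theorem cauchySeq_incl {u : ℕ → ht.FormDomain} (hu : CauchySeq u) :
    CauchySeq fun n => incl ht (u n) :=
  hu.map ((incl ht).mkContinuous 1 fun x => by rw [one_mul]; exact norm_incl_le x).uniformContinuous

theorem norm_form_sub_lt_of_cauchySeq {u : ℕ → ht.FormDomain} (hu : CauchySeq u) {ε : ℝ}
    (hε : 0 < ε) : ∃ n₀ : ℕ, ∀ m n : ℕ, n₀ ≤ m → n₀ ≤ n →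
      ‖t (incl ht (u n) - incl ht (u m)) (incl ht (u n) - incl ht (u m))‖ < ε := by
  obtain ⟨n₀, hn₀⟩ := Metric.cauchySeq_iff.1 hu (√(ε / (1 + |ht.shift|))) (by positivity)
  refine ⟨n₀, fun m n hm hn => ?_⟩
  have hlt : ‖u n - u m‖ ^ 2 < ε / (1 + |ht.shift|) := by
    rw [← Real.lt_sqrt (norm_nonneg _), ← dist_eq_norm]
    exact hn₀ n hn m hm
  rw [← map_sub]
  refine (norm_form_self_le _).trans_lt ?_
  rwa [lt_div_iff₀' (by positivity)] at hlt

instance [CompleteSpace H] : CompleteSpace ht.FormDomain := by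
  refine Metric.complete_of_cauchySeq_tendsto fun u hu => ?_
  obtain ⟨v, hv⟩ := cauchySeq_tendsto_of_complete (cauchySeq_incl hu)
  obtain ⟨hvD, hlim⟩ :=
    ht.closed _ v (fun n => (u n).incl_mem) hv fun _ => norm_form_sub_lt_of_cauchySeq hu
  let w : ht.FormDomain := (⟨v, hvD⟩ : D)
  have hw : incl ht w = v := rfl
  have hsq : Tendsto (fun n => ‖u n - w‖ ^ 2) atTop (𝓝 0) := by
    simp only [norm_sq_eq, map_sub, hw]
    have hre := (RCLike.continuous_re.tendsto _).comp hlim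
    have hnorm := ((tendsto_iff_norm_sub_tendsto_zero.1 hv).pow 2).const_mul ht.shift
    simpa using hre.add hnorm
  exact ⟨w, tendsto_iff_norm_sub_tendsto_zero.2 (by simpa using hsq.sqrt)⟩

end FormDomain

theorem exists_form_add_shift_eq_inner [CompleteSpace H] (g : H) :
    ∃ u ∈ D, ∀ z ∈ D, t u z + (ht.shift : 𝕜) * inner 𝕜 z u = inner 𝕜 z g := by
  let ℓ : ht.FormDomain →L[𝕜] 𝕜 := innerSL 𝕜 g ∘L
    (FormDomain.incl ht).mkContinuous 1 fun x => by rw [one_mul]; exact x.norm_incl_le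
  let u := (InnerProductSpace.toDual 𝕜 ht.FormDomain).symm ℓ
  refine ⟨FormDomain.incl ht u, u.incl_mem, fun z hz => ?_⟩
  let z' : ht.FormDomain := (⟨z, hz⟩ : D)
  have h : inner 𝕜 u z' = ℓ z' := InnerProductSpace.toDual_symm_apply
  rw [← inner_conj_symm z g, ← inner_conj_symm z, ht.symm z hz _ u.incl_mem,
    ← RCLike.conj_ofReal, ← map_mul, ← map_add]
  exact congrArg conj h

end IsClosedSemiboundedForm

namespace IsAssociatedOperator

theorem unique (hD : Dense (D : Set H)) {L M : H →ₗ.[𝕜] H} (hL : IsAssociatedOperator D t L)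
    (hM : IsAssociatedOperator D t M) : L = M := by
  refine LinearPMap.ext (Submodule.ext fun V => (hL.1 V).trans (hM.1 V).symm) fun V h h' => ?_
  exact hD.eq_of_inner_right 𝕜 fun Z hZ => (hL.2 ⟨V, h⟩ Z hZ).symm.trans (hM.2 ⟨V, h'⟩ Z hZ)

theorem isFormalAdjoint {L : H →ₗ.[𝕜] H} (hL : IsAssociatedOperator D t L)
    (ht : IsClosedSemiboundedForm D t) : L.IsFormalAdjoint L := fun U V => by
  have hU : (U : H) ∈ D := ((hL.1 U).1 U.2).1
  have hV : (V : H) ∈ D := ((hL.1 V).1 V.2).1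
  rw [← inner_conj_symm, ← hL.2 U V hV, ← hL.2 V U hU, ← ht.symm _ hU _ hV]

theorem isSelfAdjoint [CompleteSpace H] {L : H →ₗ.[𝕜] H} (hL : IsAssociatedOperator D t L)
    (ht : IsClosedSemiboundedForm D t) : IsSelfAdjoint L := by
  refine isSelfAdjoint_of_isFormalAdjoint_of_surjective (hL.isFormalAdjoint ht) ht.shift
    fun g => ?_
  obtain ⟨u, hu, h⟩ := ht.exists_form_add_shift_eq_inner g
  have hdom : u ∈ L.domain := (hL.1 u).2 ⟨hu, g - (ht.shift : 𝕜) • u, fun z hz => by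
    rw [inner_sub_right, inner_smul_right, ← h z hz, add_sub_cancel_right]⟩
  refine ⟨⟨u, hdom⟩, ht.dense.eq_of_inner_right 𝕜 fun z hz => ?_⟩
  rw [inner_add_right, inner_smul_right, ← hL.2 ⟨u, hdom⟩ z hz, h z hz]

end IsAssociatedOperator

end Forms

/-! ## Primitives of locally integrable functions -/

section Primitives

variable {E : Type*} [NormedAddCommGroup E] {f w : ℝ → E}

theorem intervalIntegrable_of_locallyIntegrable (hw : LocallyIntegrable w) (a b : ℝ) :
    IntervalIntegrable w volume a b :=
  intervalIntegrable_iff.2 ((hw.integrableOn_isCompact isCompact_uIcc).mono_set uIoc_subset_uIcc)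

variable [NormedSpace ℝ E]

/-- The function `f` is a primitive of the locally integrable function `w`. -/
structure IsPrimitive (f w : ℝ → E) : Prop where
  locallyIntegrable : LocallyIntegrable w
  sub_eq_integral : ∀ a b, f b - f a = ∫ x in a..b, w x

theorem isPrimitive_integral (hw : LocallyIntegrable w) (a : ℝ) :
    IsPrimitive (fun x => ∫ y in a..x, w y) w :=
  ⟨hw, fun _ _ => intervalIntegral.integral_interval_sub_left
    (intervalIntegrable_of_locallyIntegrable hw _ _)
    (intervalIntegrable_of_locallyIntegrable hw _ _)⟩

theorem isPrimitive_of_hasDerivAt [CompleteSpace E] (hw : Continuous w)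
    (h : ∀ x, HasDerivAt f (w x) x) : IsPrimitive f w :=
  ⟨hw.locallyIntegrable, fun a b => (intervalIntegral.integral_eq_sub_of_hasDerivAt
    (fun x _ => h x) (hw.intervalIntegrable a b)).symm⟩

namespace IsPrimitive

theorem absolutelyContinuousOnInterval (h : IsPrimitive f w) (a b : ℝ) :
    AbsolutelyContinuousOnInterval f a b := by
  have hint := fun x y => (intervalIntegrable_of_locallyIntegrable h.locallyIntegrable x y).norm
  have hnorm := (hint a b).absolutelyContinuousOnInterval_intervalIntegral left_mem_uIcc
  rw [absolutelyContinuousOnInterval_iff] at hnorm ⊢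
  intro ε hε
  obtain ⟨δ, hδ, hsum⟩ := hnorm ε hε
  refine ⟨δ, hδ, fun I hI hlen => (Finset.sum_le_sum fun i _ => ?_).trans_lt (hsum I hI hlen)⟩
  rw [dist_eq_norm', dist_eq_norm', h.sub_eq_integral,
    intervalIntegral.integral_interval_sub_left (hint a _) (hint a _), Real.norm_eq_abs]
  exact intervalIntegral.norm_integral_le_abs_integral_norm

protected theorem continuous (h : IsPrimitive f w) : Continuous f :=
  continuous_iff_continuousAt.2 fun x =>
    (h.absolutelyContinuousOnInterval (x - 1) (x + 1)).continuousOn.continuousAt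
      (by rw [uIcc_of_le (by linarith)]; exact Icc_mem_nhds (by linarith) (by linarith))

theorem ae_hasDerivAt [CompleteSpace E] (h : IsPrimitive f w) : ∀ᵐ x, HasDerivAt f (w x) x := by
  filter_upwards [LocallyIntegrable.ae_hasDerivAt_integral h.locallyIntegrable] with x hx
  refine ((hx 0).const_add (f 0)).congr_of_eventuallyEq (.of_forall fun y => ?_)
  simp only [← h.sub_eq_integral, add_sub_cancel]

theorem of_ae_hasDerivAt [CompleteSpace E] (hw : LocallyIntegrable w)
    (hf : ∀ a b, AbsolutelyContinuousOnInterval f a b) (h : ∀ᵐ x, HasDerivAt f (w x) x) :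
    IsPrimitive f w := by
  refine ⟨hw, fun a b => ?_⟩
  have hprim := isPrimitive_integral hw a
  obtain ⟨C, hC⟩ := ((hf a b).sub (hprim.absolutelyContinuousOnInterval a b)
    ).const_of_ae_hasDerivAt_zero (by
      filter_upwards [h, hprim.ae_hasDerivAt] with x hfx hwx _
      simpa using hfx.sub hwx)
  have heq := (hC b right_mem_uIcc).trans (hC a left_mem_uIcc).symm
  rw [Pi.sub_apply, Pi.sub_apply, intervalIntegral.integral_same, sub_zero] at heq
  rw [← heq, sub_sub_cancel]

theorem smul {K : Type*} [RCLike K] [NormedSpace K E] [CompleteSpace E]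
    {g z : ℝ → K} (hg : IsPrimitive g z) (hf : IsPrimitive f w) :
    IsPrimitive (fun x => g x • f x) (fun x => g x • w x + z x • f x) := by
  refine of_ae_hasDerivAt
    ((hf.locallyIntegrable.continuous_smul hg.continuous).add
      (hg.locallyIntegrable.smul_continuous hf.continuous))
    (fun a b => (hg.absolutelyContinuousOnInterval a b).smul
      (hf.absolutelyContinuousOnInterval a b)) ?_
  filter_upwards [hg.ae_hasDerivAt, hf.ae_hasDerivAt] with x hgx hfx using hgx.smul hfx

theorem clm_comp {F : Type*} [NormedAddCommGroup F] [NormedSpace ℝ F] [CompleteSpace E]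
    [CompleteSpace F] (T : E →L[ℝ] F) (h : IsPrimitive f w) :
    IsPrimitive (fun x => T (f x)) (fun x => T (w x)) := by
  refine ⟨locallyIntegrableOn_univ.1
    (T.locallyIntegrableOn_comp (h.locallyIntegrable.locallyIntegrableOn univ)), fun a b => ?_⟩
  rw [T.intervalIntegral_comp_comm (intervalIntegrable_of_locallyIntegrable h.locallyIntegrable a
    b), ← h.sub_eq_integral, map_sub]

theorem integral_Ioi_eq_neg (h : IsPrimitive f w) {a : ℝ} (hf : IntegrableOn f (Ioi a))
    (hw : IntegrableOn w (Ioi a)) : ∫ x in Ioi a, w x = -f a := by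
  have hlim : Tendsto f atTop (𝓝 (f a + ∫ x in Ioi a, w x)) := by
    refine ((intervalIntegral_tendsto_integral_Ioi a hw tendsto_id).const_add (f a)).congr
      fun x => ?_
    rw [id, ← h.sub_eq_integral, add_sub_cancel]
  have hint : IntegrableAtFilter f atTop volume := ⟨Ioi a, Ioi_mem_atTop a, hf⟩
  have hzero := hint.eq_zero_of_tendsto (fun s hs => by
    obtain ⟨b, hb⟩ := mem_atTop_sets.1 hs
    exact top_unique (Real.volume_Ici (a := b) ▸ measure_mono hb)) hlim
  exact (neg_eq_of_add_eq_zero_right hzero).symm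

theorem integral_Ioi_deriv_smul [CompleteSpace E] (h : IsPrimitive f w) {φ : ℝ → ℝ}
    (hφ : ContDiff ℝ 1 φ) (hc : HasCompactSupport φ) (a : ℝ) :
    ∫ x in Ioi a, deriv φ x • f x = -(φ a • f a) - ∫ x in Ioi a, φ x • w x := by
  have hd : Continuous (deriv φ) := hφ.continuous_deriv le_rfl
  have hprim : IsPrimitive φ (deriv φ) :=
    isPrimitive_of_hasDerivAt hd fun x => (hφ.differentiable one_ne_zero x).hasDerivAt
  have hf := h.continuous.locallyIntegrable (μ := volume)
  have hint := hf.integrable_smul_left_of_hasCompactSupport hφ.continuous hc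
  have hw := h.locallyIntegrable.integrable_smul_left_of_hasCompactSupport hφ.continuous hc
  have hdf := hf.integrable_smul_left_of_hasCompactSupport hd hc.deriv
  rw [eq_sub_iff_add_eq', ← integral_add hw.integrableOn hdf.integrableOn]
  exact (hprim.smul h).integral_Ioi_eq_neg hint.integrableOn
    (hw.integrableOn.add hdf.integrableOn)

end IsPrimitive

end Primitives
/-! ## The lemma of du Bois-Reymond -/

section DuBoisReymond

open TopologicalSpace
open scoped Distributions ContDiff

variable {E : Type*} [NormedAddCommGroup E] [NormedSpace ℝ E]

theorem exists_contDiff_deriv_eq_of_integral_eq_zero [CompleteSpace E] {g : ℝ → E}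
    (hg : ContDiff ℝ ∞ g) {a b : ℝ} (hs : tsupport g ⊆ Icc a b) (h0 : ∫ x, g x = 0) :
    ∃ ψ : ℝ → E, ContDiff ℝ ∞ ψ ∧ tsupport ψ ⊆ Icc a b ∧ deriv ψ = g := by
  have hg0 : ∀ x ∉ Icc a b, g x = 0 := fun x hx =>
    image_eq_zero_of_notMem_tsupport fun h => hx (hs h)
  have hint : Integrable g := hg.continuous.integrable_of_hasCompactSupport
    (isCompact_Icc.of_isClosed_subset (isClosed_tsupport g) hs)
  have hd : ∀ x, HasDerivAt (fun x => ∫ t in Iic x, g t) (g x) x := fun x => by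
    refine ((hg.continuous.integral_hasStrictDerivAt 0 x).hasDerivAt.const_add
      (∫ t in Iic 0, g t)).congr_of_eventuallyEq (.of_forall fun y => ?_)
    simp only [← intervalIntegral.integral_Iic_sub_Iic hint.integrableOn hint.integrableOn,
      add_sub_cancel]
  have hderiv := funext fun x => (hd x).deriv
  refine ⟨_, contDiff_infty_iff_deriv.2 ⟨fun x => (hd x).differentiableAt, by rwa [hderiv]⟩,
    closure_minimal (fun x hx => ?_) isClosed_Icc, hderiv⟩
  contrapose! hx
  rw [Function.notMem_support]
  rcases lt_or_ge x a with hxa | hxa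
  · exact setIntegral_eq_zero_of_forall_eq_zero fun t ht => hg0 t fun h =>
      (h.1.trans ht).not_gt hxa
  · rw [← h0]
    exact setIntegral_eq_integral_of_forall_compl_eq_zero fun t ht => hg0 t fun h =>
      ht (h.2.trans (lt_of_not_ge fun hxb => hx ⟨hxa, hxb⟩).le)

variable {Ω : Opens ℝ}

theorem exists_testFunction_deriv_eq (hΩ : (Ω : Set ℝ).OrdConnected) (φ : 𝓓(Ω, ℝ))
    (h0 : ∫ x, φ x = 0) : ∃ ψ : 𝓓(Ω, ℝ), deriv ψ = φ := by
  rcases (tsupport φ).eq_empty_or_nonempty with hφ | hφ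
  · rw [tsupport_eq_empty_iff] at hφ
    exact ⟨φ, by rw [hφ, deriv_zero]⟩
  obtain ⟨a, ha⟩ := φ.hasCompactSupport.isCompact.exists_isLeast hφ
  obtain ⟨b, hb⟩ := φ.hasCompactSupport.isCompact.exists_isGreatest hφ
  obtain ⟨ψ, hψ, hs, hd⟩ := exists_contDiff_deriv_eq_of_integral_eq_zero φ.contDiff
    (fun x hx => ⟨ha.2 hx, hb.2 hx⟩) h0
  exact ⟨⟨ψ, hψ, isCompact_Icc.of_isClosed_subset (isClosed_tsupport ψ) hs,
    hs.trans (hΩ.out (φ.tsupport_subset ha.1) (φ.tsupport_subset hb.1))⟩, hd⟩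

theorem exists_testFunction_integral_eq_one (hΩ : (Ω : Set ℝ).Nonempty) :
    ∃ θ : 𝓓(Ω, ℝ), ∫ x, θ x = 1 := by
  obtain ⟨x, hx⟩ := hΩ
  obtain ⟨r, hr, hrΩ⟩ := Metric.nhds_basis_closedBall.mem_iff.1 (Ω.isOpen.mem_nhds hx)
  let B : ContDiffBump x := ⟨r / 2, r, half_pos hr, half_lt_self hr⟩
  exact ⟨⟨B.normed volume, B.contDiff_normed, B.hasCompactSupport_normed,
    B.tsupport_normed_eq.trans_subset hrΩ⟩, B.integral_normed⟩

theorem integrable_testFunction_smul {d : ℝ → E} (hd : LocallyIntegrableOn d Ω) (φ : 𝓓(Ω, ℝ)) :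
    Integrable fun x => φ x • d x :=
  φ.integrable_bilin (.lsmul ℝ ℝ) hd

theorem ae_eq_const_of_forall_integral_deriv_smul_eq_zero [CompleteSpace E]
    (hΩ : (Ω : Set ℝ).OrdConnected) {d : ℝ → E} (hd : LocallyIntegrableOn d Ω)
    (h : ∀ φ : 𝓓(Ω, ℝ), ∫ x, deriv φ x • d x = 0) :
    ∃ c, d =ᵐ[volume.restrict Ω] fun _ => c := by
  rcases (Ω : Set ℝ).eq_empty_or_nonempty with hempty | hne
  · exact ⟨0, by simp only [hempty, Measure.restrict_empty, ae_zero, EventuallyEq, eventually_bot]⟩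
  obtain ⟨θ, hθ⟩ := exists_testFunction_integral_eq_one hne
  have integrable : ∀ φ : 𝓓(Ω, ℝ), Integrable φ := fun φ =>
    φ.continuous.integrable_of_hasCompactSupport φ.hasCompactSupport
  have integral_smul_eq : ∀ φ : 𝓓(Ω, ℝ),
      ∫ x, φ x • d x = (∫ x, φ x) • ∫ x, θ x • d x := fun φ => by
    obtain ⟨ψ, hψ⟩ := exists_testFunction_deriv_eq hΩ (φ - (∫ x, φ x) • θ) (by
      simp only [sub_apply, smul_apply, smul_eq_mul]
      rw [integral_sub (integrable φ) ((integrable θ).const_mul _), integral_const_mul, hθ,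
        mul_one, sub_self])
    have hzero := h ψ
    simp only [hψ, sub_apply, smul_apply, sub_smul, smul_assoc] at hzero
    rwa [integral_sub (integrable_testFunction_smul hd φ)
      ((integrable_testFunction_smul hd θ).fun_smul _), integral_smul, sub_eq_zero] at hzero
  refine ⟨∫ x, θ x • d x, (ae_restrict_iff' Ω.isOpen.measurableSet).2 ?_⟩
  refine (Ω.isOpen.ae_eq_zero_of_integral_contDiff_smul_eq_zero
    (hd.sub (locallyIntegrableOn_const _)) fun g hg hc hs => ?_).mono
      fun x hx hxΩ => sub_eq_zero.1 (hx hxΩ)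
  let φ : 𝓓(Ω, ℝ) := ⟨g, hg, hc, hs⟩
  calc ∫ x, g x • (d x - ∫ x, θ x • d x)
      = (∫ x, φ x • d x) - ∫ x, φ x • ∫ x, θ x • d x := by
        simp only [smul_sub]
        exact integral_sub (integrable_testFunction_smul hd φ) ((integrable φ).smul_const _)
    _ = 0 := by rw [integral_smul_const, integral_smul_eq, sub_self]

end DuBoisReymond
/-! ## Sobolev functions on the half-line -/

section Sobolev

open TopologicalSpace
open scoped Distributions

variable {𝕜 : Type*} [RCLike 𝕜] {u v w : L2Half 𝕜}

/-- The open half-line `(0, ∞)`, as the domain of Mathlib's test functions. -/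
abbrev positiveReals : Opens ℝ := ⟨Ioi 0, isOpen_Ioi⟩

variable (𝕜) in
/-- The class in `L²(ℝ₊; 𝕜)` of a real square-integrable function. -/
def realToL2 {φ : ℝ → ℝ} (hφ : MemLp φ 2 halfLine) : L2Half 𝕜 :=
  (hφ.ofReal (K := 𝕜)).toLp _

theorem coeFn_realToL2 {φ : ℝ → ℝ} (hφ : MemLp φ 2 halfLine) :
    realToL2 𝕜 hφ =ᵐ[halfLine] fun x => (φ x : 𝕜) :=
  MemLp.coeFn_toLp _

theorem inner_realToL2 {φ : ℝ → ℝ} (hφ : MemLp φ 2 halfLine) (u : L2Half 𝕜) :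
    inner 𝕜 (realToL2 𝕜 hφ) u = ∫ x in Ioi 0, φ x • u x := by
  rw [L2.inner_def]
  refine integral_congr_ae ?_
  filter_upwards [coeFn_realToL2 (𝕜 := 𝕜) hφ] with x hx
  rw [hx, RCLike.inner_apply, RCLike.conj_ofReal, RCLike.real_smul_eq_coe_mul, mul_comm]

theorem testFunction_apply_zero (φ : 𝓓(positiveReals, ℝ)) : φ 0 = 0 :=
  image_eq_zero_of_notMem_tsupport fun h => lt_irrefl (0 : ℝ) (φ.tsupport_subset h)

theorem memLp_testFunction (φ : 𝓓(positiveReals, ℝ)) : MemLp φ 2 halfLine :=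
  φ.continuous.memLp_of_hasCompactSupport φ.hasCompactSupport

theorem continuous_deriv_testFunction (φ : 𝓓(positiveReals, ℝ)) : Continuous (deriv φ) :=
  φ.contDiff.continuous_deriv (by simp)

theorem memLp_deriv_testFunction (φ : 𝓓(positiveReals, ℝ)) : MemLp (deriv φ) 2 halfLine :=
  (continuous_deriv_testFunction φ).memLp_of_hasCompactSupport φ.hasCompactSupport.deriv

theorem hasWeakDeriv_iff_inner : HasWeakDeriv u w ↔ ∀ φ : 𝓓(positiveReals, ℝ),
    inner 𝕜 (realToL2 𝕜 (memLp_deriv_testFunction φ)) u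
      = -inner 𝕜 (realToL2 𝕜 (memLp_testFunction φ)) w := by
  simp only [inner_realToL2]
  exact ⟨fun h φ => h φ φ.contDiff φ.hasCompactSupport φ.tsupport_subset,
    fun h φ hφ hc hs => h ⟨φ, hφ, hc, hs⟩⟩

theorem HasWeakDeriv.of_tendsto {ι : Type*} {l : Filter ι} [l.NeBot] {U W : ι → L2Half 𝕜}
    (h : ∀ i, HasWeakDeriv (U i) (W i)) (hu : Tendsto U l (𝓝 u)) (hw : Tendsto W l (𝓝 w)) :
    HasWeakDeriv u w :=
  hasWeakDeriv_iff_inner.2 fun φ => tendsto_nhds_unique (tendsto_const_nhds.inner hu)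
    ((tendsto_const_nhds.inner hw).neg.congr fun i => (hasWeakDeriv_iff_inner.1 (h i) φ).symm)

theorem eq_zero_of_forall_inner_testFunction_eq_zero
    (h : ∀ φ : 𝓓(positiveReals, ℝ), inner 𝕜 (realToL2 𝕜 (memLp_testFunction φ)) w = 0) :
    w = 0 :=
  HasWeakDeriv.unique
    (hasWeakDeriv_iff_inner.2 fun φ => by rw [inner_zero_right, h, neg_zero]) .zero

theorem IsPrimitive.integral_Ioi_deriv_testFunction_smul {f g : ℝ → 𝕜} (h : IsPrimitive f g)
    (hg : w =ᵐ[halfLine] g) (φ : 𝓓(positiveReals, ℝ)) :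
    ∫ x in Ioi 0, deriv φ x • f x = -∫ x in Ioi 0, φ x • w x := by
  rw [h.integral_Ioi_deriv_smul (φ.contDiff.of_le (by simp)) φ.hasCompactSupport,
    testFunction_apply_zero, zero_smul, neg_zero, zero_sub]
  exact congrArg Neg.neg
    (integral_congr_ae (hg.mono fun x hx => congrArg (φ x • ·) hx.symm))

theorem IsPrimitive.hasWeakDeriv {f g : ℝ → 𝕜} (h : IsPrimitive f g) (hf : u =ᵐ[halfLine] f)
    (hg : w =ᵐ[halfLine] g) : HasWeakDeriv u w := fun φ hφ hc hs =>
  (integral_congr_ae (hf.mono fun x hx => congrArg (deriv φ x • ·) hx)).trans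
    (h.integral_Ioi_deriv_testFunction_smul hg ⟨φ, hφ, hc, hs⟩)

theorem hasWeakDeriv_realToL2 {φ ψ : ℝ → ℝ} (hφ : MemLp φ 2 halfLine) (hψ : MemLp ψ 2 halfLine)
    (hc : Continuous ψ) (h : ∀ x, HasDerivAt φ (ψ x) x) :
    HasWeakDeriv (realToL2 𝕜 hφ) (realToL2 𝕜 hψ) :=
  ((isPrimitive_of_hasDerivAt hc h).clm_comp RCLike.ofRealCLM).hasWeakDeriv
    (coeFn_realToL2 hφ) (coeFn_realToL2 hψ)

theorem hasValueAtZero_realToL2 {φ : ℝ → ℝ} (hφ : MemLp φ 2 halfLine) (hc : Continuous φ) :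
    HasValueAtZero (realToL2 𝕜 hφ) (φ 0 : 𝕜) :=
  ⟨_, (RCLike.continuous_ofReal.comp hc).continuousOn, coeFn_realToL2 hφ, rfl⟩

theorem hasWeakDeriv_testFunction (φ : 𝓓(positiveReals, ℝ)) :
    HasWeakDeriv (realToL2 𝕜 (memLp_testFunction φ))
      (realToL2 𝕜 (memLp_deriv_testFunction φ)) :=
  hasWeakDeriv_realToL2 _ _ (continuous_deriv_testFunction φ)
    fun x => (φ.contDiff.differentiable (by simp) x).hasDerivAt

theorem hasValueAtZero_testFunction (φ : 𝓓(positiveReals, ℝ)) :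
    HasValueAtZero (realToL2 𝕜 (memLp_testFunction φ)) 0 := by
  have h := hasValueAtZero_realToL2 (𝕜 := 𝕜) (memLp_testFunction φ) φ.continuous
  rwa [testFunction_apply_zero, RCLike.ofReal_zero] at h

variable (𝕜) in
theorem exists_memH1_hasValueAtZero_one : ∃ u : L2Half 𝕜, MemH1 u ∧ HasValueAtZero u 1 := by
  have hc : Continuous fun x : ℝ => Real.exp (-x) := Real.continuous_exp.comp continuous_neg
  have hexp : MemLp (fun x => Real.exp (-x)) 2 halfLine := by
    rw [memLp_two_iff_integrable_sq hc.aestronglyMeasurable]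
    refine (integrableOn_exp_mul_Ioi (a := -2) (by norm_num) 0).congr_fun (fun x _ => ?_)
      measurableSet_Ioi
    simp only [← Real.exp_nat_mul, Nat.cast_ofNat, neg_mul, mul_neg]
  refine ⟨realToL2 𝕜 hexp, ⟨realToL2 𝕜 hexp.neg, hasWeakDeriv_realToL2 _ _ hc.neg fun x => ?_⟩, ?_⟩
  · simpa using! (Real.hasDerivAt_exp (-x)).comp x (hasDerivAt_neg x)
  · simpa using hasValueAtZero_realToL2 (𝕜 := 𝕜) hexp hc

theorem locallyIntegrable_indicator_coeFn (w : L2Half 𝕜) :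
    LocallyIntegrable ((Ioi (0 : ℝ)).indicator w) :=
  ((memLp_indicator_iff_restrict measurableSet_Ioi).2 (Lp.memLp w)).locallyIntegrable one_le_two

theorem indicator_coeFn_ae_eq (w : L2Half 𝕜) : (Ioi (0 : ℝ)).indicator w =ᵐ[halfLine] w :=
  indicator_ae_eq_restrict measurableSet_Ioi

theorem HasWeakDeriv.integral_deriv_smul_sub_eq_zero (h : HasWeakDeriv u w) {f : ℝ → 𝕜}
    (hf : IsPrimitive f ((Ioi 0).indicator w)) (φ : 𝓓(positiveReals, ℝ)) :
    ∫ x, deriv φ x • ((Ioi 0).indicator u x - f x) = 0 := by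
  have hd := continuous_deriv_testFunction φ
  have hint := (hf.continuous.locallyIntegrable (μ := volume)
    ).integrable_smul_left_of_hasCompactSupport hd φ.hasCompactSupport.deriv
  have hvanish : ∀ x ∉ Ioi (0 : ℝ), deriv φ x • ((Ioi 0).indicator u x - f x) = 0 :=
    fun x hx => by rw [image_eq_zero_of_notMem_tsupport fun hx' =>
      hx (φ.tsupport_subset (tsupport_deriv_subset hx')), zero_smul]
  calc ∫ x, deriv φ x • ((Ioi 0).indicator u x - f x)
      = ∫ x in Ioi 0, (deriv φ x • u x - deriv φ x • f x) := by
        rw [← setIntegral_eq_integral_of_forall_compl_eq_zero hvanish]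
        refine integral_congr_ae ((indicator_coeFn_ae_eq u).mono fun x hx => ?_)
        simp only [hx, smul_sub]
    _ = 0 := by
        rw [integral_sub (integrable_test_smul hd φ.hasCompactSupport.deriv u) hint.integrableOn,
          h φ φ.contDiff φ.hasCompactSupport φ.tsupport_subset,
          hf.integral_Ioi_deriv_testFunction_smul (indicator_coeFn_ae_eq w).symm, sub_self]

theorem HasWeakDeriv.exists_isPrimitive (h : HasWeakDeriv u w) :
    ∃ f : ℝ → 𝕜, IsPrimitive f ((Ioi 0).indicator w) ∧ u =ᵐ[halfLine] f := by
  have hW := isPrimitive_integral (locallyIntegrable_indicator_coeFn w) 0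
  set W : ℝ → 𝕜 := fun x => ∫ y in (0 : ℝ)..x, (Ioi 0).indicator w y
  obtain ⟨c, hc⟩ := ae_eq_const_of_forall_integral_deriv_smul_eq_zero (Ω := positiveReals)
    ordConnected_Ioi (((locallyIntegrable_indicator_coeFn u).sub
      hW.continuous.locallyIntegrable).locallyIntegrableOn _) (h.integral_deriv_smul_sub_eq_zero hW)
  refine ⟨fun x => c + W x, ⟨hW.locallyIntegrable, fun a b => ?_⟩, ?_⟩
  · rw [add_sub_add_left_eq_sub, hW.sub_eq_integral]
  · filter_upwards [hc, indicator_coeFn_ae_eq u] with x hx hu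
    rw [← hu, ← sub_eq_iff_eq_add]
    exact hx

theorem MemH1.exists_isPrimitive (h : MemH1 u) :
    ∃ f : ℝ → 𝕜, IsPrimitive f ((Ioi 0).indicator (weakDeriv u)) ∧ u =ᵐ[halfLine] f ∧
      f 0 = valueAtZero u := by
  obtain ⟨f, hf, hu⟩ := h.hasWeakDeriv.exists_isPrimitive
  exact ⟨f, hf, hu, (HasValueAtZero.valueAtZero_eq ⟨f, hf.continuous.continuousOn, hu, rfl⟩).symm⟩

theorem MemH1.hasValueAtZero (h : MemH1 u) : HasValueAtZero u (valueAtZero u) := by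
  obtain ⟨f, hf, hu, hf0⟩ := h.exists_isPrimitive
  exact ⟨f, hf.continuous.continuousOn, hu, hf0⟩

theorem MemH1.inner_weakDeriv_add (hu : MemH1 u) (hv : MemH1 v) :
    inner 𝕜 v (weakDeriv u) + inner 𝕜 (weakDeriv v) u
      = -(valueAtZero u * conj (valueAtZero v)) := by
  obtain ⟨f, hf, huf, hf0⟩ := hu.exists_isPrimitive
  obtain ⟨g, hg, hvg, hg0⟩ := hv.exists_isPrimitive
  have hconj : IsPrimitive (fun x => conj (g x))
      fun x => conj ((Ioi 0).indicator (weakDeriv v) x) :=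
    hg.clm_comp (RCLike.conjCLE : 𝕜 ≃L[ℝ] 𝕜).toContinuousLinearMap
  have hint := (L2.integrable_inner (𝕜 := 𝕜) v (weakDeriv u)).add
    (L2.integrable_inner (weakDeriv v) u)
  have hval : (fun x => inner 𝕜 (v x) (u x)) =ᵐ[halfLine] fun x => f x • conj (g x) := by
    filter_upwards [huf, hvg] with x hux hvx
    rw [RCLike.inner_apply, hux, hvx, smul_eq_mul]
  have hderiv : (fun x => inner 𝕜 (v x) (weakDeriv u x) + inner 𝕜 (weakDeriv v x) (u x))
      =ᵐ[halfLine] fun x => f x • conj ((Ioi 0).indicator (weakDeriv v) x)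
        + (Ioi 0).indicator (weakDeriv u) x • conj (g x) := by
    filter_upwards [huf, hvg, indicator_coeFn_ae_eq (weakDeriv u),
      indicator_coeFn_ae_eq (weakDeriv v)] with x hux hvx hu' hv'
    rw [RCLike.inner_apply, RCLike.inner_apply, hux, hvx, hu', hv', add_comm, smul_eq_mul,
      smul_eq_mul]
  calc inner 𝕜 v (weakDeriv u) + inner 𝕜 (weakDeriv v) u
      = ∫ x in Ioi 0, (inner 𝕜 (v x) (weakDeriv u x) + inner 𝕜 (weakDeriv v x) (u x)) := by
        rw [L2.inner_def, L2.inner_def, integral_add (L2.integrable_inner _ _)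
          (L2.integrable_inner _ _)]
    _ = -(valueAtZero u * conj (valueAtZero v)) := by
        rw [integral_congr_ae hderiv, ← hf0, ← hg0]
        exact (hf.smul hconj).integral_Ioi_eq_neg
          ((L2.integrable_inner v u).congr hval) (hint.congr hderiv)

theorem MemH1.sq_norm_valueAtZero_le (hu : MemH1 u) :
    ‖valueAtZero u‖ ^ 2 ≤ 2 * (‖u‖ * ‖weakDeriv u‖) :=
  calc ‖valueAtZero u‖ ^ 2
      = ‖inner 𝕜 u (weakDeriv u) + inner 𝕜 (weakDeriv u) u‖ := by
        rw [hu.inner_weakDeriv_add hu, norm_neg, norm_mul, RCLike.norm_conj, sq]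
    _ ≤ ‖u‖ * ‖weakDeriv u‖ + ‖weakDeriv u‖ * ‖u‖ :=
        norm_add_le_of_le (norm_inner_le_norm _ _) (norm_inner_le_norm _ _)
    _ = 2 * (‖u‖ * ‖weakDeriv u‖) := by ring

theorem valueAtZero_add (hu : MemH1 u) (hv : MemH1 v) :
    valueAtZero (u + v) = valueAtZero u + valueAtZero v :=
  (hu.hasValueAtZero.add hv.hasValueAtZero).valueAtZero_eq

theorem valueAtZero_smul (c : 𝕜) (hu : MemH1 u) : valueAtZero (c • u) = c * valueAtZero u :=
  (hu.hasValueAtZero.smul c).valueAtZero_eq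

theorem MemH1.sub (hu : MemH1 u) (hv : MemH1 v) : MemH1 (u - v) := by
  rw [sub_eq_add_neg, ← neg_one_smul 𝕜 v]
  exact hu.add (hv.smul _)

theorem weakDeriv_sub (hu : MemH1 u) (hv : MemH1 v) :
    weakDeriv (u - v) = weakDeriv u - weakDeriv v := by
  rw [sub_eq_add_neg, ← neg_one_smul 𝕜 v, weakDeriv_add hu (hv.smul _), weakDeriv_smul _ hv,
    neg_one_smul, ← sub_eq_add_neg]

theorem valueAtZero_sub (hu : MemH1 u) (hv : MemH1 v) :
    valueAtZero (u - v) = valueAtZero u - valueAtZero v := by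
  rw [sub_eq_add_neg, ← neg_one_smul 𝕜 v, valueAtZero_add hu (hv.smul _), valueAtZero_smul _ hv,
    neg_one_mul, ← sub_eq_add_neg]

theorem tendsto_valueAtZero {ι : Type*} {l : Filter ι} {U : ι → L2Half 𝕜}
    (hU : ∀ i, MemH1 (U i)) (hu : MemH1 u) (h : Tendsto U l (𝓝 u))
    (h' : Tendsto (fun i => weakDeriv (U i)) l (𝓝 (weakDeriv u))) :
    Tendsto (fun i => valueAtZero (U i)) l (𝓝 (valueAtZero u)) := by
  have hlim := ((tendsto_iff_norm_sub_tendsto_zero.1 h).mul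
    (tendsto_iff_norm_sub_tendsto_zero.1 h')).const_mul 2
  rw [mul_zero, mul_zero] at hlim
  have hsq : Tendsto (fun i => ‖valueAtZero (U i) - valueAtZero u‖ ^ 2) l (𝓝 0) :=
    squeeze_zero (fun i => sq_nonneg _) (fun i => by
      rw [← valueAtZero_sub (hU i) hu, ← weakDeriv_sub (hU i) hu]
      exact ((hU i).sub hu).sq_norm_valueAtZero_le) hlim
  exact tendsto_iff_norm_sub_tendsto_zero.2 (by simpa using hsq.sqrt)

end Sobolev

/-! ## Schrödinger operators with a delta vertex condition -/

section Multiplication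

variable {𝕜 : Type*} [RCLike 𝕜] {q : ℝ → ℝ} (hq : MemLp q ∞ halfLine) (u v : L2Half 𝕜)

theorem coeFn_mulBounded : mulBounded q hq u =ᵐ[halfLine] fun x => (q x : 𝕜) * u x :=
  MemLp.coeFn_toLp (MemLp.mul' (r := 2) (Lp.memLp u) hq.ofReal)

theorem inner_mulBounded : inner 𝕜 v (mulBounded q hq u) = inner 𝕜 (mulBounded q hq v) u := by
  rw [L2.inner_def, L2.inner_def]
  refine integral_congr_ae ?_
  filter_upwards [coeFn_mulBounded hq u, coeFn_mulBounded hq v] with x hu hv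
  rw [hu, hv, RCLike.inner_apply, RCLike.inner_apply, map_mul, RCLike.conj_ofReal]
  ring

theorem norm_mulBounded_le : ‖mulBounded q hq u‖ ≤ lpNorm q ∞ halfLine * ‖u‖ := by
  refine Lp.norm_le_mul_norm_of_ae_le_mul ?_
  filter_upwards [coeFn_mulBounded hq u, ae_le_lpNorm_exponent_top hq] with x hu hqx
  rw [hu, norm_mul, RCLike.norm_ofReal, ← Real.norm_eq_abs]
  gcongr

end Multiplication

section Star

open TopologicalSpace
open scoped Distributions

variable {𝕜 : Type*} [RCLike 𝕜] {N : ℕ} {U V Z : L2Star 𝕜 N}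

/-- The edgewise weak derivative `V'`. -/
def derivStar (V : L2Star 𝕜 N) : L2Star 𝕜 N := WithLp.toLp 2 fun j => weakDeriv (V j)

theorem derivStar_apply (V : L2Star 𝕜 N) (j : Fin N) : derivStar V j = weakDeriv (V j) := rfl

theorem derivStar_add (hU : U ∈ energySpace 𝕜 N) (hV : V ∈ energySpace 𝕜 N) :
    derivStar (U + V) = derivStar U + derivStar V :=
  PiLp.ext fun j => weakDeriv_add (hU.1 j) (hV.1 j)

theorem derivStar_smul (c : 𝕜) (hU : U ∈ energySpace 𝕜 N) :
    derivStar (c • U) = c • derivStar U :=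
  PiLp.ext fun j => weakDeriv_smul c (hU.1 j)

theorem derivStar_sub (hU : U ∈ energySpace 𝕜 N) (hV : V ∈ energySpace 𝕜 N) :
    derivStar (U - V) = derivStar U - derivStar V :=
  PiLp.ext fun j => weakDeriv_sub (hU.1 j) (hV.1 j)

/-- The edgewise multiplication by bounded potentials. -/
def mulStar (q : Fin N → ℝ → ℝ) (hq : ∀ j, MemLp (q j) ∞ halfLine) :
    L2Star 𝕜 N →ₗ[𝕜] L2Star 𝕜 N where
  toFun V := WithLp.toLp 2 fun j => mulBounded (q j) (hq j) (V j)
  map_add' _ _ := PiLp.ext fun _ => map_add _ _ _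
  map_smul' c V := PiLp.ext fun j => map_smul (mulBounded (q j) (hq j)) c (V j)

theorem mulStar_apply (q : Fin N → ℝ → ℝ) (hq : ∀ j, MemLp (q j) ∞ halfLine) (V : L2Star 𝕜 N)
    (j : Fin N) : mulStar q hq V j = mulBounded (q j) (hq j) (V j) := rfl

theorem inner_mulStar (q : Fin N → ℝ → ℝ) (hq : ∀ j, MemLp (q j) ∞ halfLine) (U V : L2Star 𝕜 N) :
    inner 𝕜 V (mulStar q hq U) = inner 𝕜 (mulStar q hq V) U := by
  simp only [PiLp.inner_apply, mulStar_apply, inner_mulBounded]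

theorem norm_mulStar_le (q : Fin N → ℝ → ℝ) (hq : ∀ j, MemLp (q j) ∞ halfLine)
    (V : L2Star 𝕜 N) : ‖mulStar q hq V‖ ≤ (∑ j, lpNorm (q j) ∞ halfLine) * ‖V‖ := by
  have hC : 0 ≤ ∑ j, lpNorm (q j) ∞ halfLine := Finset.sum_nonneg fun j _ => lpNorm_nonneg
  refine le_of_sq_le_sq ?_ (by positivity)
  rw [mul_pow, PiLp.norm_sq_eq_of_L2, PiLp.norm_sq_eq_of_L2, Finset.mul_sum]
  refine Finset.sum_le_sum fun j _ => ?_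
  have hj : lpNorm (q j) ∞ halfLine ≤ ∑ i, lpNorm (q i) ∞ halfLine :=
    Finset.single_le_sum (fun i _ => lpNorm_nonneg) (Finset.mem_univ j)
  rw [← mul_pow, mulStar_apply]
  gcongr
  exact (norm_mulBounded_le _ _).trans (by gcongr)

theorem sq_norm_valueAtZero_le (hV : ∀ j, MemH1 (V j)) (j : Fin N) :
    ‖valueAtZero (V j)‖ ^ 2 ≤ 2 * (‖V‖ * ‖derivStar V‖) := by
  refine (hV j).sq_norm_valueAtZero_le.trans ?_
  rw [← derivStar_apply]
  gcongr <;> exact PiLp.norm_apply_le _ j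

theorem inner_single_left (j : Fin N) (u : L2Half 𝕜) (V : L2Star 𝕜 N) :
    inner 𝕜 (PiLp.single 2 j u : L2Star 𝕜 N) V = inner 𝕜 u (V j) := by
  rw [PiLp.inner_apply, Finset.sum_eq_single j (fun i _ hij => by
    rw [PiLp.single_eq_of_ne 2 hij, inner_zero_left]) fun h => absurd (Finset.mem_univ j) h,
    PiLp.single_eq_same]

theorem derivStar_single (j : Fin N) (u : L2Half 𝕜) :
    derivStar (PiLp.single 2 j u : L2Star 𝕜 N) = PiLp.single 2 j (weakDeriv u) := by
  refine PiLp.ext fun i => ?_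
  rw [derivStar_apply]
  obtain rfl | hij := eq_or_ne i j
  · rw [PiLp.single_eq_same, PiLp.single_eq_same]
  · rw [PiLp.single_eq_of_ne 2 hij, PiLp.single_eq_of_ne 2 hij, weakDeriv_zero]

theorem hasValueAtZero_single {u : L2Half 𝕜} (h : HasValueAtZero u 0) (i j : Fin N) :
    HasValueAtZero ((PiLp.single 2 j u : L2Star 𝕜 N) i) 0 := by
  obtain rfl | hij := eq_or_ne i j
  · rwa [PiLp.single_eq_same]
  · rw [PiLp.single_eq_of_ne 2 hij]
    exact .zero

theorem single_mem_energySpace {u : L2Half 𝕜} (h : MemH1 u) (h0 : HasValueAtZero u 0)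
    (j : Fin N) : (PiLp.single 2 j u : L2Star 𝕜 N) ∈ energySpace 𝕜 N := by
  refine ⟨fun i => ?_, 0, fun i => hasValueAtZero_single h0 i j⟩
  obtain rfl | hij := eq_or_ne i j
  · rwa [PiLp.single_eq_same]
  · rw [PiLp.single_eq_of_ne 2 hij]
    exact ⟨0, .zero⟩

theorem single_testFunction_mem_energySpace (j : Fin N) (φ : 𝓓(positiveReals, ℝ)) :
    (PiLp.single 2 j (realToL2 𝕜 (memLp_testFunction φ)) : L2Star 𝕜 N) ∈ energySpace 𝕜 N :=
  single_mem_energySpace ⟨_, hasWeakDeriv_testFunction φ⟩ (hasValueAtZero_testFunction φ) j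

theorem dense_energySpace : Dense (energySpace 𝕜 N : Set (L2Star 𝕜 N)) := by
  rw [Submodule.dense_iff_topologicalClosure_eq_top, Submodule.topologicalClosure_eq_top_iff,
    Submodule.eq_bot_iff]
  refine fun W hW => PiLp.ext fun j => eq_zero_of_forall_inner_testFunction_eq_zero fun φ => ?_
  rw [← inner_single_left]
  exact (Submodule.mem_orthogonal _ _).1 hW _ (single_testFunction_mem_energySpace j φ)

variable [NeZero N]

theorem hasValueAtZero_of_mem_energySpace (hV : V ∈ energySpace 𝕜 N) (j : Fin N) :
    HasValueAtZero (V j) (valueAtZero (V 0)) := by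
  obtain ⟨_, a, ha⟩ := hV
  rw [(ha 0).valueAtZero_eq]
  exact ha j

theorem mem_energySpace_of_tendsto {ι : Type*} {l : Filter ι} [l.NeBot] {u : ι → L2Star 𝕜 N}
    (hu : ∀ i, u i ∈ energySpace 𝕜 N) (hV : Tendsto u l (𝓝 V))
    (hZ : Tendsto (fun i => derivStar (u i)) l (𝓝 Z)) :
    V ∈ energySpace 𝕜 N ∧ derivStar V = Z := by
  have happly {a : ι → L2Star 𝕜 N} {b : L2Star 𝕜 N} (h : Tendsto a l (𝓝 b)) (j : Fin N) :
      Tendsto (fun i => a i j) l (𝓝 (b j)) :=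
    ((PiLp.continuous_apply 2 _ j).tendsto b).comp h
  have hweak (j : Fin N) : HasWeakDeriv (V j) (Z j) :=
    .of_tendsto (fun i => ((hu i).1 j).hasWeakDeriv) (happly hV j) (happly hZ j)
  have hval (j : Fin N) : Tendsto (fun i => valueAtZero (u i j)) l (𝓝 (valueAtZero (V j))) :=
    tendsto_valueAtZero (fun i => (hu i).1 j) ⟨_, hweak j⟩ (happly hV j)
      ((hweak j).weakDeriv_eq ▸ happly hZ j)
  have hvertex (j : Fin N) : valueAtZero (V j) = valueAtZero (V 0) :=
    tendsto_nhds_unique (hval j) ((hval 0).congr fun i =>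
      (hasValueAtZero_of_mem_energySpace (hu i) j).valueAtZero_eq.symm)
  exact ⟨⟨fun j => ⟨_, hweak j⟩, valueAtZero (V 0),
    fun j => hvertex j ▸ MemH1.hasValueAtZero ⟨_, hweak j⟩⟩,
    PiLp.ext fun j => (hweak j).weakDeriv_eq⟩

end Star

section DeltaForm

open TopologicalSpace
open scoped Distributions

variable {𝕜 : Type*} [RCLike 𝕜] {N : ℕ} {F V Z W : L2Star 𝕜 N}

/-- The form `(F', G')₂ + (q F, G)₂ + α F(0) G(0)`, with complex conjugation on `G(0)`; its domain
is `energySpace 𝕜 N`. -/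
def deltaForm [NeZero N] (α : ℝ) (q : Fin N → ℝ → ℝ) (hq : ∀ j, MemLp (q j) ∞ halfLine)
    (F G : L2Star 𝕜 N) : 𝕜 :=
  inner 𝕜 (derivStar G) (derivStar F) + inner 𝕜 G (mulStar q hq F)
    + (α : 𝕜) * (valueAtZero (F 0) * conj (valueAtZero (G 0)))

/-- A constant `K` for which `K ‖F‖² + ‖F'‖² / 2` dominates the potential and vertex terms of
`deltaForm`. -/
def deltaFormBound (α : ℝ) (q : Fin N → ℝ → ℝ) : ℝ :=
  ∑ j, lpNorm (q j) ∞ halfLine + 2 * α ^ 2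

variable (α : ℝ) (q : Fin N → ℝ → ℝ) (hq : ∀ j, MemLp (q j) ∞ halfLine)

theorem deltaFormBound_nonneg : 0 ≤ deltaFormBound α q :=
  add_nonneg (Finset.sum_nonneg fun _ _ => lpNorm_nonneg) (by positivity)

theorem deltaDomain_le_energySpace : deltaDomain 𝕜 N α ≤ energySpace 𝕜 N :=
  fun _ ⟨hV, a, _, ha, _⟩ => ⟨fun j => (hV j).1, a, ha⟩

theorem schrodinger_apply (V : deltaDomain 𝕜 N α) :
    schrodinger 𝕜 α q hq V = mulStar q hq V - derivStar (derivStar (V : L2Star 𝕜 N)) :=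
  PiLp.ext fun _ => neg_add_eq_sub _ _

variable [NeZero N]

theorem norm_vertexTerm_le (hF : ∀ j, MemH1 (F j)) :
    ‖(α : 𝕜) * (valueAtZero (F 0) * conj (valueAtZero (F 0)))‖
      ≤ ‖derivStar F‖ ^ 2 / 2 + 2 * α ^ 2 * ‖F‖ ^ 2 :=
  calc ‖(α : 𝕜) * (valueAtZero (F 0) * conj (valueAtZero (F 0)))‖
      = |α| * ‖valueAtZero (F 0)‖ ^ 2 := by
        rw [norm_mul, norm_mul, RCLike.norm_conj, RCLike.norm_ofReal, ← sq]
    _ ≤ |α| * (2 * (‖F‖ * ‖derivStar F‖)) := by gcongr; exact sq_norm_valueAtZero_le hF 0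
    _ ≤ ‖derivStar F‖ ^ 2 / 2 + 2 * |α| ^ 2 * ‖F‖ ^ 2 := by
        linarith [sq_nonneg (‖derivStar F‖ - 2 * (|α| * ‖F‖))]
    _ = ‖derivStar F‖ ^ 2 / 2 + 2 * α ^ 2 * ‖F‖ ^ 2 := by rw [sq_abs]

theorem norm_deltaForm_self_sub_le (hF : ∀ j, MemH1 (F j)) :
    ‖deltaForm α q hq F F - ((‖derivStar F‖ ^ 2 : ℝ) : 𝕜)‖
      ≤ ‖derivStar F‖ ^ 2 / 2 + deltaFormBound α q * ‖F‖ ^ 2 := by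
  have hpot : ‖inner 𝕜 F (mulStar q hq F)‖ ≤ (∑ j, lpNorm (q j) ∞ halfLine) * ‖F‖ ^ 2 :=
    calc ‖inner 𝕜 F (mulStar q hq F)‖ ≤ ‖F‖ * ‖mulStar q hq F‖ := norm_inner_le_norm _ _
      _ ≤ ‖F‖ * ((∑ j, lpNorm (q j) ∞ halfLine) * ‖F‖) := by
        gcongr; exact norm_mulStar_le q hq F
      _ = (∑ j, lpNorm (q j) ∞ halfLine) * ‖F‖ ^ 2 := by ring
  rw [deltaForm, inner_self_eq_norm_sq_to_K, RCLike.ofReal_pow, add_assoc, add_sub_cancel_left]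
  refine (norm_add_le_of_le hpot (norm_vertexTerm_le α hF)).trans_eq ?_
  rw [deltaFormBound]
  ring

theorem sq_norm_derivStar_le (hF : ∀ j, MemH1 (F j)) :
    ‖derivStar F‖ ^ 2 ≤ 2 * RCLike.re (deltaForm α q hq F F) +
      2 * deltaFormBound α q * ‖F‖ ^ 2 := by
  have h := (RCLike.abs_re_le_norm _).trans (norm_deltaForm_self_sub_le α q hq hF)
  rw [map_sub, RCLike.ofReal_re] at h
  linarith [(abs_le.1 h).1]

theorem norm_deltaForm_self_le (hF : ∀ j, MemH1 (F j)) :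
    ‖deltaForm α q hq F F‖ ≤ 2 * ‖derivStar F‖ ^ 2 + deltaFormBound α q * ‖F‖ ^ 2 := by
  have h := norm_le_norm_add_norm_sub' (deltaForm α q hq F F) ((‖derivStar F‖ ^ 2 : ℝ) : 𝕜)
  rw [RCLike.norm_ofReal, abs_of_nonneg (sq_nonneg _)] at h
  linarith [norm_deltaForm_self_sub_le α q hq hF, sq_nonneg ‖derivStar F‖]

theorem cauchySeq_derivStar {u : ℕ → L2Star 𝕜 N} (hu : ∀ n, u n ∈ energySpace 𝕜 N)
    (hcau : CauchySeq u)
    (hform : ∀ ε : ℝ, 0 < ε → ∃ n₀ : ℕ, ∀ m n : ℕ, n₀ ≤ m → n₀ ≤ n →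
      ‖deltaForm α q hq (u n - u m) (u n - u m)‖ < ε) :
    CauchySeq fun n => derivStar (u n) := by
  have hK := deltaFormBound_nonneg α q
  refine Metric.cauchySeq_iff.2 fun ε hε => ?_
  obtain ⟨n₁, hn₁⟩ := hform (ε ^ 2 / 4) (by positivity)
  obtain ⟨n₂, hn₂⟩ := Metric.cauchySeq_iff.1 hcau (√(ε ^ 2 / (4 * (deltaFormBound α q + 1))))
    (by positivity)
  refine ⟨max n₁ n₂, fun m hm n hn => ?_⟩
  have hre : RCLike.re (deltaForm α q hq (u m - u n) (u m - u n)) < ε ^ 2 / 4 :=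
    (RCLike.re_le_norm _).trans_lt (hn₁ n m (le_of_max_le_left hn) (le_of_max_le_left hm))
  have hsq : ‖u m - u n‖ ^ 2 * (4 * (deltaFormBound α q + 1)) < ε ^ 2 := by
    rw [← lt_div_iff₀ (by positivity), ← Real.lt_sqrt (norm_nonneg _), ← dist_eq_norm]
    exact hn₂ m (le_of_max_le_right hm) n (le_of_max_le_right hn)
  have hderiv := sq_norm_derivStar_le α q hq ((energySpace 𝕜 N).sub_mem (hu m) (hu n)).1
  rw [derivStar_sub (hu m) (hu n), ← dist_eq_norm] at hderiv
  refine lt_of_pow_lt_pow_left₀ 2 hε.le ?_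
  linarith [sq_nonneg ‖u m - u n‖]

theorem tendsto_deltaForm_sub_self {ι : Type*} {l : Filter ι} {u : ι → L2Star 𝕜 N}
    (hu : ∀ i, u i ∈ energySpace 𝕜 N) (hV : V ∈ energySpace 𝕜 N) (h : Tendsto u l (𝓝 V))
    (h' : Tendsto (fun i => derivStar (u i)) l (𝓝 (derivStar V))) :
    Tendsto (fun i => deltaForm α q hq (u i - V) (u i - V)) l (𝓝 0) := by
  have hlim := (((tendsto_iff_norm_sub_tendsto_zero.1 h').pow 2).const_mul 2).add
    (((tendsto_iff_norm_sub_tendsto_zero.1 h).pow 2).const_mul (deltaFormBound α q))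
  rw [zero_pow two_ne_zero, mul_zero, mul_zero, add_zero] at hlim
  refine squeeze_zero_norm (fun i => ?_) hlim
  rw [← derivStar_sub (hu i) hV]
  exact norm_deltaForm_self_le α q hq ((energySpace 𝕜 N).sub_mem (hu i) hV).1

theorem isClosedSemiboundedForm_deltaForm :
    IsClosedSemiboundedForm (energySpace 𝕜 N) (deltaForm α q hq) where
  dense := dense_energySpace
  add_left u hu v hv z _ := by
    rw [deltaForm, deltaForm, deltaForm, derivStar_add hu hv, inner_add_right, map_add,
      inner_add_right, PiLp.add_apply, valueAtZero_add (hu.1 0) (hv.1 0)]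
    ring
  smul_left c u hu z _ := by
    rw [deltaForm, deltaForm, derivStar_smul c hu, inner_smul_right, map_smul,
      inner_smul_right, PiLp.smul_apply, valueAtZero_smul c (hu.1 0)]
    ring
  symm u _ v _ := by
    rw [deltaForm, deltaForm, map_add, map_add, map_mul, map_mul, inner_conj_symm,
      RCLike.conj_ofReal, RCLike.conj_conj, inner_mulStar q hq u v, inner_conj_symm]
    ring
  bounded_below := ⟨-deltaFormBound α q, fun u hu => by
    linarith [sq_norm_derivStar_le α q hq hu.1, sq_nonneg ‖derivStar u‖]⟩
  closed u v hu hv hform := by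
    obtain ⟨w, hw⟩ := cauchySeq_tendsto_of_complete
      (cauchySeq_derivStar α q hq hu hv.cauchySeq hform)
    obtain ⟨hvE, rfl⟩ := mem_energySpace_of_tendsto hu hv hw
    exact ⟨hvE, tendsto_deltaForm_sub_self α q hq hu hvE hv hw⟩

theorem deltaForm_eq_of_memH2 (hV : ∀ j, MemH2 (V j)) (hZ : Z ∈ energySpace 𝕜 N) :
    deltaForm α q hq V Z = inner 𝕜 Z (mulStar q hq V - derivStar (derivStar V))
      + ((α : 𝕜) * valueAtZero (V 0) - ∑ j, valueAtZero (weakDeriv (V j)))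
        * conj (valueAtZero (Z 0)) := by
  have hparts : inner 𝕜 (derivStar Z) (derivStar V) = -inner 𝕜 Z (derivStar (derivStar V))
      - (∑ j, valueAtZero (weakDeriv (V j))) * conj (valueAtZero (Z 0)) := by
    rw [PiLp.inner_apply, PiLp.inner_apply, Finset.sum_mul, ← Finset.sum_neg_distrib,
      ← Finset.sum_sub_distrib]
    refine Finset.sum_congr rfl fun j _ => ?_
    have hj := (hV j).2.inner_weakDeriv_add (hZ.1 j)
    rw [(hasValueAtZero_of_mem_energySpace hZ j).valueAtZero_eq] at hj
    simp only [derivStar_apply]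
    linear_combination hj
  rw [deltaForm, hparts, inner_sub_right]
  ring

theorem deltaForm_eq_inner_schrodinger (V : deltaDomain 𝕜 N α) (hZ : Z ∈ energySpace 𝕜 N) :
    deltaForm α q hq V Z = inner 𝕜 Z (schrodinger 𝕜 α q hq V) := by
  obtain ⟨hV, a, b, ha, hb, hab⟩ := V.2
  rw [deltaForm_eq_of_memH2 α q hq hV hZ, schrodinger_apply, (ha 0).valueAtZero_eq,
    Finset.sum_congr rfl fun j _ => (hb j).valueAtZero_eq, hab, sub_self, zero_mul, add_zero]

theorem deltaForm_single_testFunction (V : L2Star 𝕜 N) (j : Fin N) (φ : 𝓓(positiveReals, ℝ)) :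
    deltaForm α q hq V (PiLp.single 2 j (realToL2 𝕜 (memLp_testFunction φ)))
      = inner 𝕜 (realToL2 𝕜 (memLp_deriv_testFunction φ)) (weakDeriv (V j))
        + inner 𝕜 (realToL2 𝕜 (memLp_testFunction φ)) (mulStar q hq V j) := by
  rw [deltaForm, derivStar_single, inner_single_left, inner_single_left,
    (hasWeakDeriv_testFunction φ).weakDeriv_eq, derivStar_apply,
    (hasValueAtZero_single (hasValueAtZero_testFunction φ) 0 j).valueAtZero_eq, map_zero, mul_zero,
    mul_zero, add_zero]

section Represented

variable {α q hq} (hW : ∀ Z ∈ energySpace 𝕜 N, deltaForm α q hq V Z = inner 𝕜 Z W)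
include hW

theorem hasWeakDeriv_weakDeriv_of_represented (j : Fin N) :
    HasWeakDeriv (weakDeriv (V j)) (mulStar q hq V j - W j) :=
  hasWeakDeriv_iff_inner.2 fun φ => by
    have hφ := hW _ (single_testFunction_mem_energySpace j φ)
    rw [deltaForm_single_testFunction, inner_single_left] at hφ
    rw [inner_sub_right]
    linear_combination hφ

theorem sum_valueAtZero_weakDeriv_of_represented (hV : ∀ j, MemH2 (V j)) :
    ∑ j, valueAtZero (weakDeriv (V j)) = (α : 𝕜) * valueAtZero (V 0) := by
  obtain ⟨e, he, he1⟩ := exists_memH1_hasValueAtZero_one 𝕜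
  have hE : (WithLp.toLp 2 (fun _ => e) : L2Star 𝕜 N) ∈ energySpace 𝕜 N :=
    ⟨fun _ => he, 1, fun _ => he1⟩
  have hWeq : mulStar q hq V - derivStar (derivStar V) = W := PiLp.ext fun j => by
    rw [PiLp.sub_apply, derivStar_apply, derivStar_apply,
      (hasWeakDeriv_weakDeriv_of_represented hW j).weakDeriv_eq, sub_sub_cancel]
  have htest := hW _ hE
  rw [deltaForm_eq_of_memH2 α q hq hV hE, hWeq, PiLp.toLp_apply, he1.valueAtZero_eq, map_one,
    mul_one, add_eq_left, sub_eq_zero] at htest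
  exact htest.symm

theorem mem_deltaDomain_of_represented (hV : V ∈ energySpace 𝕜 N) : V ∈ deltaDomain 𝕜 N α := by
  have hV2 (j : Fin N) : MemH2 (V j) :=
    ⟨hV.1 j, _, hasWeakDeriv_weakDeriv_of_represented hW j⟩
  exact ⟨hV2, _, _, hasValueAtZero_of_mem_energySpace hV, fun j => (hV2 j).2.hasValueAtZero,
    sum_valueAtZero_weakDeriv_of_represented hW hV2⟩

end Represented

theorem isAssociatedOperator_schrodinger :
    IsAssociatedOperator (energySpace 𝕜 N) (deltaForm α q hq) (schrodinger 𝕜 α q hq) :=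
  ⟨fun V => ⟨fun hV => ⟨deltaDomain_le_energySpace α hV, _,
    fun _ => deltaForm_eq_inner_schrodinger α q hq ⟨V, hV⟩⟩,
    fun ⟨hV, _, hW⟩ => mem_deltaDomain_of_represented hW hV⟩,
    fun V _ => deltaForm_eq_inner_schrodinger α q hq V⟩

theorem form_eq_deltaForm {k : ℕ} {α ω p c : ℝ}
    (hq : ∀ j, MemLp (potential N k α ω p c j) ∞ halfLine) :
    form 𝕜 N k α ω p c = deltaForm α (potential N k α ω p c) hq := by
  funext F G
  rw [form, deltaForm, PiLp.inner_apply, PiLp.inner_apply, ← Finset.sum_add_distrib]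
  congr 1
  refine Finset.sum_congr rfl fun j _ => ?_
  rw [L2.inner_def, L2.inner_def, ← integral_add (L2.integrable_inner _ _)
    (L2.integrable_inner _ _)]
  refine integral_congr_ae ?_
  filter_upwards [coeFn_mulBounded (hq j) (F j)] with x hx
  rw [mulStar_apply, hx, RCLike.inner_apply, RCLike.inner_apply, derivStar_apply, derivStar_apply,
    potential, RCLike.ofReal_sub]
  ring

end DeltaForm

end StarGraph

end

open StarGraph in
theorem theorem3p2_general {𝕜 : Type*} [RCLike 𝕜] {N : ℕ} [NeZero N] (α : ℝ) (q : Fin N → ℝ → ℝ)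
    (hq : ∀ j, MemLp (q j) ∞ halfLine) :
    IsClosedSemiboundedForm (energySpace 𝕜 N) (deltaForm α q hq) ∧
      IsSelfAdjoint (schrodinger 𝕜 α q hq) ∧
      ∀ L : L2Star 𝕜 N →ₗ.[𝕜] L2Star 𝕜 N,
        IsAssociatedOperator (energySpace 𝕜 N) (deltaForm α q hq) L ↔ L = schrodinger 𝕜 α q hq := by
  have hform := isClosedSemiboundedForm_deltaForm (𝕜 := 𝕜) α q hq
  have hassoc := isAssociatedOperator_schrodinger (𝕜 := 𝕜) α q hq
  refine ⟨hform, hassoc.isSelfAdjoint hform, fun L => ⟨fun hL => hL.unique hform.dense hassoc, ?_⟩⟩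
  rintro rfl
  exact hassoc

theorem theorem3p2 {𝕜 : Type*} [RCLike 𝕜] {N : ℕ} [NeZero N] (k : ℕ) (hk : k ≤ (N - 1) / 2)
    (α ω p : ℝ) (hα : α ≠ 0) (hp : 1 < p) (hω : α ^ 2 / ((N : ℝ) - 2 * k) ^ 2 < ω) :
    (StarGraph.IsClosedSemiboundedForm (StarGraph.energySpace 𝕜 N) (StarGraph.formB1 𝕜 N k α ω p) ∧
      IsSelfAdjoint (StarGraph.schrodinger 𝕜 α (StarGraph.potential N k α ω p p)
          (StarGraph.memLp_potential p hp hω)) ∧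
      ∀ L : StarGraph.L2Star 𝕜 N →ₗ.[𝕜] StarGraph.L2Star 𝕜 N,
        StarGraph.IsAssociatedOperator (StarGraph.energySpace 𝕜 N) (StarGraph.formB1 𝕜 N k α ω p) L ↔
          L = StarGraph.schrodinger 𝕜 α (StarGraph.potential N k α ω p p)
          (StarGraph.memLp_potential p hp hω)) ∧
    (StarGraph.IsClosedSemiboundedForm (StarGraph.energySpace 𝕜 N) (StarGraph.formB2 𝕜 N k α ω p) ∧
      IsSelfAdjoint (StarGraph.schrodinger 𝕜 α (StarGraph.potential N k α ω p 1)
          (StarGraph.memLp_potential 1 hp hω)) ∧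
      ∀ L : StarGraph.L2Star 𝕜 N →ₗ.[𝕜] StarGraph.L2Star 𝕜 N,
        StarGraph.IsAssociatedOperator (StarGraph.energySpace 𝕜 N) (StarGraph.formB2 𝕜 N k α ω p) L ↔
          L = StarGraph.schrodinger 𝕜 α (StarGraph.potential N k α ω p 1)
          (StarGraph.memLp_potential 1 hp hω)) := by
  rw [StarGraph.formB1, StarGraph.formB2,
    StarGraph.form_eq_deltaForm (StarGraph.memLp_potential p hp hω),
    StarGraph.form_eq_deltaForm (StarGraph.memLp_potential 1 hp hω)]
  exact ⟨theorem3p2_general _ _ _, theorem3p2_general _ _ _⟩
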